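/- Let $n\ge 1$ and let $M^{2n+1}(\varphi,\xi,\eta,g)$ be a $K$-contact manifold, that is, a smooth $(2n+1)$-dimensional Riemannian manifold $(M,g)$ with a $(1,1)$-tensor field $\varphi$, a unit Killing vector field $\xi$ and a $1$-form $\eta$ such that $$\varphi^2=-I+\eta\otimes\xi,\qquad \eta=g(\cdot,\xi),\qquad d\eta(X,Y)=g(X,\varphi Y),$$ where $d\eta(X,Y)=\tfrac12\{X(\eta(Y))-Y(\eta(X))-\eta([X,Y])\}$. Suppose that $M$ carries a closed $(m,\rho)$-quasi-Einstein structure with $m\neq 1$, that is, there are a smooth vector field $V$ and real numbers $m>0$, $\rho$, $\lambda$ with $m\ne 1$ such that $$\tfrac12\,\mathcal L_Vg+\mathrm{Ric}-\tfrac1m\,V^\flat\otimes V^\flat=(\lambda+\rho\,r)\,g,\qquad dV^\flat=0,$$ where $\mathrm{Ric}$ and $r$ are the Ricci tensor and the scalar curvature of $g$ and $V^\flat=g(V,\cdot)$. Then $M$ is Einstein with $\mathrm{Ric}=2n\,g$, and its scalar curvature is constant, $r=2n(2n+1)$. Moreover, $V=0$ identically or $\lambda+\rho\,r=2n+m$.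 -/

import Mathlib

open Bundle FiberBundle VectorField
open scoped Manifold ContDiff

noncomputable section

namespace RiemGeom

/-- A positive definite symmetric bilinear form on a finite-dimensional real vector space has an
orthonormal basis. -/
theorem exists_basis_orthonormal {W : Type*} [AddCommGroup W] [Module ℝ W] [FiniteDimensional ℝ W]
    (B : W →ₗ[ℝ] W →ₗ[ℝ] ℝ) (hs : ∀ u v, B u v = B v u) (hp : ∀ u, u ≠ 0 → 0 < B u u) :
    ∃ b : Module.Basis (Fin (Module.finrank ℝ W)) ℝ W,
      ∀ i j, B (b i) (b j) = if i = j then 1 else 0 := by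
  let c : InnerProductSpace.Core ℝ W :=
    { inner := fun u v ↦ B u v
      conj_inner_symm := fun u v ↦ hs v u
      re_inner_nonneg := fun u ↦ by
        rcases eq_or_ne u 0 with rfl | h
        · simp
        · exact (hp u h).le
      add_left := fun u v w ↦ by simp
      smul_left := fun u v r ↦ by simp
      definite := fun u hu ↦ by
        by_contra h
        exact (hp u h).ne' hu }
  let _ : NormedAddCommGroup W := c.toNormedAddCommGroup
  let _ : InnerProductSpace ℝ W := InnerProductSpace.ofCore c.toCore
  let b := stdOrthonormalBasis ℝ W
  refine ⟨b.toBasis, fun i j ↦ ?_⟩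
  have := orthonormal_iff_ite.1 b.orthonormal i j
  simpa using! this

variable {E : Type*} [NormedAddCommGroup E] [NormedSpace ℝ E] [FiniteDimensional ℝ E]
  {H : Type*} [TopologicalSpace H] {I : ModelWithCorners ℝ E H}
  {M : Type*} [TopologicalSpace M] [ChartedSpace H M] [IsManifold I ∞ M]
  (g : ContMDiffRiemannianMetric I ∞ E (fun x : M ↦ TangentSpace I x))

/-- Every tangent space has a basis that is orthonormal for the metric. -/
theorem exists_orthonormal_basis (x : M) :
    ∃ b : Module.Basis (Fin (Module.finrank ℝ E)) ℝ (TangentSpace I x),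
      ∀ i j, g.inner x (b i) (b j) = if i = j then 1 else 0 :=
  have : FiniteDimensional ℝ (TangentSpace I x) := inferInstanceAs (FiniteDimensional ℝ E)
  exists_basis_orthonormal (g.inner x).toLinearMap₁₂ (g.symm x) (g.pos x)

/-- An orthonormal basis `e_1, …, e_d` of the tangent space at `x`. -/
def frame (x : M) : Module.Basis (Fin (Module.finrank ℝ E)) ℝ (TangentSpace I x) :=
  (exists_orthonormal_basis g x).choose

theorem inner_frame (x : M) (i j : Fin (Module.finrank ℝ E)) :
    g.inner x (frame g x i) (frame g x j) = if i = j then 1 else 0 :=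
  (exists_orthonormal_basis g x).choose_spec i j

theorem sum_inner_frame (x : M) (v : TangentSpace I x) :
    ∑ i, g.inner x v (frame g x i) • frame g x i = v := by
  have h : ∀ i, g.inner x v (frame g x i) = (frame g x).repr v i := fun i ↦ by
    conv_lhs => rw [← (frame g x).sum_repr v, map_sum, sum_apply]
    simp [inner_frame]
  simp only [h]
  exact (frame g x).sum_repr v

theorem mdiff_inner {x : M} {Y Z : Π x : M, TangentSpace I x}
    (hY : MDiffAt (T% Y) x) (hZ : MDiffAt (T% Z) x) :
    MDifferentiableAt I 𝓘(ℝ) (fun y ↦ g.inner y (Y y) (Z y)) x := by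
  let _ : RiemannianBundle (fun x : M ↦ TangentSpace I x) := ⟨g.toRiemannianMetric⟩
  have : IsContMDiffRiemannianBundle I 1 E (fun x : M ↦ TangentSpace I x) :=
    IsContMDiffRiemannianBundle.of_le (n := ∞) (by norm_cast)
  exact MDifferentiableAt.inner_bundle (F := E) (E := fun x : M ↦ TangentSpace I x)
    (b := fun y : M ↦ y) hY hZ

/-- Half the right-hand side of the Koszul formula. -/
def koszul (X Y Z : Π x : M, TangentSpace I x) (x : M) : ℝ :=
  (mvfderiv I (fun y ↦ g.inner y (Y y) (Z y)) x (X x)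
    + mvfderiv I (fun y ↦ g.inner y (X y) (Z y)) x (Y x)
    - mvfderiv I (fun y ↦ g.inner y (X y) (Y y)) x (Z x)
    + g.inner x (mlieBracket I X Y x) (Z x)
    - g.inner x (mlieBracket I X Z x) (Y x)
    - g.inner x (mlieBracket I Y Z x) (X x)) / 2

theorem koszul_tensorial_left {x : M} {Y Z : Π x : M, TangentSpace I x}
    (hY : MDiffAt (T% Y) x) (hZ : MDiffAt (T% Z) x) :
    TensorialAt I E (fun X ↦ koszul g X Y Z x) x where
  smul {f X} hf hX := by
    have h1 := mvfderiv_fun_mul hf (mdiff_inner g hX hZ)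
    have h2 := mvfderiv_fun_mul hf (mdiff_inner g hX hY)
    simp [koszul, mlieBracket_smul_left hf hX, h1, h2, g.symm x (Y x) (X x), g.symm x (Z x) (X x)]
    ring
  add {X X'} hX hX' := by
    have h1 := mvfderiv_fun_add (mdiff_inner g hX hZ) (mdiff_inner g hX' hZ)
    have h2 := mvfderiv_fun_add (mdiff_inner g hX hY) (mdiff_inner g hX' hY)
    simp [koszul, mlieBracket_add_left hX hX', h1, h2]
    ring

theorem koszul_tensorial_right {x : M} {X Y : Π x : M, TangentSpace I x}
    (hX : MDiffAt (T% X) x) (hY : MDiffAt (T% Y) x) :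
    TensorialAt I E (fun Z ↦ koszul g X Y Z x) x where
  smul {f Z} hf hZ := by
    have h1 := mvfderiv_fun_mul hf (mdiff_inner g hY hZ)
    have h2 := mvfderiv_fun_mul hf (mdiff_inner g hX hZ)
    simp [koszul, mlieBracket_smul_right hf hZ, h1, h2, g.symm x (Z x) (X x),
      g.symm x (Z x) (Y x)]
    ring
  add {Z Z'} hZ hZ' := by
    have h1 := mvfderiv_fun_add (mdiff_inner g hY hZ) (mdiff_inner g hY hZ')
    have h2 := mvfderiv_fun_add (mdiff_inner g hX hZ) (mdiff_inner g hX hZ')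
    simp [koszul, mlieBracket_add_right hZ hZ', h1, h2]
    ring

theorem koszul_add_middle {x : M} {X Y Y' Z : Π x : M, TangentSpace I x}
    (hX : MDiffAt (T% X) x) (hY : MDiffAt (T% Y) x) (hY' : MDiffAt (T% Y') x)
    (hZ : MDiffAt (T% Z) x) :
    koszul g X (Y + Y') Z x = koszul g X Y Z x + koszul g X Y' Z x := by
  have h1 := mvfderiv_fun_add (mdiff_inner g hY hZ) (mdiff_inner g hY' hZ)
  have h2 := mvfderiv_fun_add (mdiff_inner g hX hY) (mdiff_inner g hX hY')
  simp [koszul, mlieBracket_add_right hY hY', mlieBracket_add_left hY hY', h1, h2]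
  ring

theorem koszul_smul_middle {x : M} {f : M → ℝ} {X Y Z : Π x : M, TangentSpace I x}
    (hf : MDiffAt f x) (hX : MDiffAt (T% X) x) (hY : MDiffAt (T% Y) x)
    (hZ : MDiffAt (T% Z) x) :
    koszul g X (f • Y) Z x =
      f x * koszul g X Y Z x + mvfderiv I f x (X x) * g.inner x (Y x) (Z x) := by
  have h1 := mvfderiv_fun_mul hf (mdiff_inner g hY hZ)
  have h2 := mvfderiv_fun_mul hf (mdiff_inner g hX hY)
  simp [koszul, mlieBracket_smul_right hf hY, mlieBracket_smul_left hf hY, h1, h2,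
    g.symm x (Y x) (X x)]
  ring

open Classical in
/-- The Levi-Civita covariant derivative of a vector field `Y` at `x`: the endomorphism `u ↦ ∇_u Y`
whose components `g(∇_u Y, e_i)` in an orthonormal basis are given by the Koszul formula. -/
def leviCivitaFun (Y : Π x : M, TangentSpace I x) (x : M) :
    TangentSpace I x →L[ℝ] TangentSpace I x :=
  if hY : MDiffAt (T% Y) x then
    ∑ i, (TensorialAt.mkHom (fun X ↦ koszul g X Y (extend E (frame g x i)) x) x
      (koszul_tensorial_left g hY (mdifferentiableAt_extend ..))).smulRight (frame g x i)
  else 0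

theorem leviCivitaFun_apply {Y : Π x : M, TangentSpace I x} {x : M} (hY : MDiffAt (T% Y) x)
    (u : TangentSpace I x) :
    leviCivitaFun g Y x u =
      ∑ i, koszul g (extend E u) Y (extend E (frame g x i)) x • frame g x i := by
  simp only [leviCivitaFun, dif_pos hY]
  simp [TensorialAt.mkHom_apply_eq_extend]

/-- The Levi-Civita connection of the metric `g`. -/
def leviCivita : CovariantDerivative I E (fun x : M ↦ TangentSpace I x) where
  toFun := leviCivitaFun g
  isCovariantDerivativeOnUniv :=
    { add := fun {Y Y' x} hY hY' _ ↦ by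
        ext u
        rw [add_apply, leviCivitaFun_apply g hY, leviCivitaFun_apply g hY',
          leviCivitaFun_apply g (mdifferentiableAt_add_section hY hY'), ← Finset.sum_add_distrib]
        refine Finset.sum_congr rfl fun i _ ↦ ?_
        rw [koszul_add_middle g (mdifferentiableAt_extend ..) hY hY'
          (mdifferentiableAt_extend ..), add_smul]
      leibniz := fun {Y f x} hY hf _ ↦ by
        ext u
        rw [leviCivitaFun_apply g (hf.smul_section hY)]
        have h : ∀ i, koszul g (extend E u) (f • Y) (extend E (frame g x i)) x
            • frame g x i = f x • (koszul g (extend E u) Y (extend E (frame g x i)) x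
              • frame g x i) + mvfderiv I f x u • (g.inner x (Y x) (frame g x i) • frame g x i) :=
          fun i ↦ by
            rw [koszul_smul_middle g hf (mdifferentiableAt_extend ..) hY
              (mdifferentiableAt_extend ..), add_smul, mul_smul, mul_smul, extend_apply_self,
              extend_apply_self]
        simp only [h, Finset.sum_add_distrib, ← Finset.smul_sum, sum_inner_frame,
          ← leviCivitaFun_apply g hY]
        simp }

/-- The Koszul formula. -/
theorem inner_leviCivita {X Y Z : Π x : M, TangentSpace I x} {x : M} (hX : MDiffAt (T% X) x)
    (hY : MDiffAt (T% Y) x) (hZ : MDiffAt (T% Z) x) :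
    g.inner x (leviCivita g Y x (X x)) (Z x) = koszul g X Y Z x := by
  have h1 : leviCivita g Y x (X x) =
      ∑ i, koszul g X Y (extend E (frame g x i)) x • frame g x i := by
    refine (leviCivitaFun_apply g hY (X x)).trans (Finset.sum_congr rfl fun i _ ↦ ?_)
    rw [(koszul_tensorial_left g hY (mdifferentiableAt_extend ..)).pointwise
      (mdifferentiableAt_extend ..) hX (extend_apply_self ..)]
  have h2 : koszul g X Y Z x =
      TensorialAt.mkHom (fun Z ↦ koszul g X Y Z x) x (koszul_tensorial_right g hX hY) (Z x) :=
    (TensorialAt.mkHom_apply (koszul_tensorial_right g hX hY) hZ).symm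
  rw [h1, h2]
  conv_rhs => rw [← sum_inner_frame g x (Z x)]
  simp only [map_sum, map_smul, sum_apply, smul_apply,
    TensorialAt.mkHom_apply_eq_extend, smul_eq_mul]
  exact Finset.sum_congr rfl fun i _ ↦ by rw [g.symm, mul_comm]

/-- The Levi-Civita connection is torsion-free. -/
theorem torsion_leviCivita {X Y : Π x : M, TangentSpace I x} {x : M} (hX : MDiffAt (T% X) x)
    (hY : MDiffAt (T% Y) x) :
    leviCivita g Y x (X x) - leviCivita g X x (Y x) = mlieBracket I X Y x := by
  have key : ∀ w : TangentSpace I x, g.inner x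
      (leviCivita g Y x (X x) - leviCivita g X x (Y x) - mlieBracket I X Y x) w = 0 := fun w ↦ by
    have hw := mdifferentiableAt_extend I E (x := x) w
    have h1 := inner_leviCivita g hX hY hw
    have h2 := inner_leviCivita g hY hX hw
    rw [extend_apply_self] at h1 h2
    have h3 : (fun y ↦ g.inner y (Y y) (X y)) = fun y ↦ g.inner y (X y) (Y y) :=
      funext fun y ↦ g.symm y _ _
    have h4 := mlieBracket_swap_apply (I := I) (V := Y) (W := X) (x := x)
    simp only [map_sub, sub_apply, h1, h2, koszul, extend_apply_self, h3, h4, map_neg, neg_apply]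
    ring
  by_contra h
  exact (g.pos x _ (sub_ne_zero.2 h)).ne' (key _)

/-- The Levi-Civita connection is compatible with the metric. -/
theorem compatible_leviCivita {X Y Z : Π x : M, TangentSpace I x} {x : M} (hX : MDiffAt (T% X) x)
    (hY : MDiffAt (T% Y) x) (hZ : MDiffAt (T% Z) x) :
    mvfderiv I (fun y ↦ g.inner y (Y y) (Z y)) x (X x) =
      g.inner x (leviCivita g Y x (X x)) (Z x) + g.inner x (Y x) (leviCivita g Z x (X x)) := by
  have h3 : (fun y ↦ g.inner y (Z y) (Y y)) = fun y ↦ g.inner y (Y y) (Z y) :=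
    funext fun y ↦ g.symm y _ _
  have h4 := mlieBracket_swap_apply (I := I) (V := Z) (W := Y) (x := x)
  rw [g.symm x (Y x), inner_leviCivita g hX hY hZ, inner_leviCivita g hX hZ hY]
  simp only [koszul, h3, h4, map_neg, neg_apply]
  ring

/-- The curvature tensor `R(u, v) w = ∇_U ∇_V W - ∇_V ∇_U W - ∇_[U, V] W` at `x`, where `U`, `V`,
`W` are vector fields, smooth near `x`, with values `u`, `v`, `w` at `x`. -/
def riemann (x : M) (u v w : TangentSpace I x) : TangentSpace I x :=
  leviCivita g (fun y ↦ leviCivita g (extend E w) y (extend E v y)) x u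
    - leviCivita g (fun y ↦ leviCivita g (extend E w) y (extend E u y)) x v
    - leviCivita g (extend E w) x (mlieBracket I (extend E u) (extend E v) x)

/-- The Ricci tensor `Ric(u, v) = ∑ i, g(R(e_i, u) v, e_i)`. -/
def ricci (x : M) (u v : TangentSpace I x) : ℝ :=
  ∑ i, g.inner x (riemann g x (frame g x i) u v) (frame g x i)

/-- The scalar curvature `r = ∑ i, Ric(e_i, e_i)`. -/
def scalarCurvature (x : M) : ℝ :=
  ∑ i, ricci g x (frame g x i) (frame g x i)

/-- The Lie derivative of the metric,
`(L_V g)(u, w) = V(g(U, W)) - g([V, U], W) - g(U, [V, W])`, where `U`, `W` are vector fields, smooth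
near `x`, with values `u`, `w` at `x`. -/
def lieDerivMetric (V : Π x : M, TangentSpace I x) (x : M) (u w : TangentSpace I x) : ℝ :=
  mvfderiv I (fun y ↦ g.inner y (extend E u y) (extend E w y)) x (V x)
    - g.inner x (mlieBracket I V (extend E u) x) w
    - g.inner x u (mlieBracket I V (extend E w) x)

/-- The exterior derivative of a `1`-form, in the normalization usual in contact geometry:
`dα(u, v) = (U(α(V)) - V(α(U)) - α([U, V])) / 2`, where `U`, `V` are vector fields, smooth near `x`,
with values `u`, `v` at `x`. -/
def extDerivOneForm (α : Π x : M, TangentSpace I x →L[ℝ] ℝ) (x : M) (u v : TangentSpace I x) : ℝ :=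
  (mvfderiv I (fun y ↦ α y (extend E v y)) x u
    - mvfderiv I (fun y ↦ α y (extend E u y)) x v
    - α x (mlieBracket I (extend E u) (extend E v) x)) / 2

/-- The `1`-form `V^♭ = g(V, ·)`. -/
def flat (V : Π x : M, TangentSpace I x) (x : M) : TangentSpace I x →L[ℝ] ℝ :=
  g.inner x (V x)

/-- `(φ, ξ, η, g)` is a contact metric structure. -/
structure IsContactMetric (φ : Π x : M, TangentSpace I x →L[ℝ] TangentSpace I x)
    (ξ : Π x : M, TangentSpace I x) (η : Π x : M, TangentSpace I x →L[ℝ] ℝ) : Prop where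
  smooth_φ : ContMDiff I (I.prod 𝓘(ℝ, E →L[ℝ] E)) ∞
    (fun x ↦ TotalSpace.mk' (E →L[ℝ] E) (E := fun x : M ↦ TangentSpace I x →L[ℝ] TangentSpace I x)
      x (φ x))
  smooth_ξ : ContMDiff I I.tangent ∞ (fun x ↦ (⟨x, ξ x⟩ : TangentBundle I M))
  unit_ξ : ∀ x, g.inner x (ξ x) (ξ x) = 1
  φ_sq : ∀ (x : M) (u : TangentSpace I x), φ x (φ x u) = -u + η x u • ξ x
  η_eq : ∀ (x : M) (u : TangentSpace I x), η x u = g.inner x u (ξ x)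
  dη_eq : ∀ (x : M) (u v : TangentSpace I x), extDerivOneForm η x u v = g.inner x u (φ x v)

/-- `(φ, ξ, η, g)` is a K-contact structure: a contact metric structure whose Reeb vector field `ξ`
is Killing. -/
structure IsKContact (φ : Π x : M, TangentSpace I x →L[ℝ] TangentSpace I x)
    (ξ : Π x : M, TangentSpace I x) (η : Π x : M, TangentSpace I x →L[ℝ] ℝ) : Prop
    extends IsContactMetric g φ ξ η where
  killing : ∀ (x : M) (u v : TangentSpace I x), lieDerivMetric g ξ x u v = 0

/-- `V` and `lam` define an `(m, ρ)`-quasi-Einstein structure on `(M, g)`: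
`½ L_V g + Ric - (1/m) V^♭ ⊗ V^♭ = (lam + ρ r) g` with `m > 0`. -/
structure IsQuasiEinstein (m ρ lam : ℝ) (V : Π x : M, TangentSpace I x) : Prop where
  m_pos : 0 < m
  smooth_V : ContMDiff I I.tangent ∞ (fun x ↦ (⟨x, V x⟩ : TangentBundle I M))
  equation : ∀ (x : M) (u v : TangentSpace I x),
    (1 / 2) * lieDerivMetric g V x u v + ricci g x u v - (1 / m) * (flat g V x u * flat g V x v)
      = (lam + ρ * scalarCurvature g x) * g.inner x u v

/-- An `(m, ρ)`-quasi-Einstein structure is closed if `d V^♭ = 0`. -/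
structure IsClosedQuasiEinstein (m ρ lam : ℝ) (V : Π x : M, TangentSpace I x) : Prop
    extends IsQuasiEinstein g m ρ lam V where
  closed : ∀ (x : M) (u v : TangentSpace I x), extDerivOneForm (flat g V) x u v = 0

end RiemGeom

end

set_option linter.unusedSectionVars false

/-! Write d = 2n+1 for the dimension, N = d - 1 = 2n, A = ∇ξ (which is -φ), f = g(V, ξ), μ = λ + ρr
and κ = (μ - N - m)/m. Closedness makes ∇V symmetric, so the structure equation reads ∇_X V = μX +
g(V, X)V/m - QX, with Q the Ricci operator.

K-contact geometry supplies g(R(X, ξ)ξ, Z) = g(X, Z) - η(X)η(Z) (`ip_curv_reeb_reeb`) and Qξ = Nξ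
(`ric_reeb`), and the contracted Bianchi identity then gives ξr = 0 (`der_reeb_scal`). Comparing
g(R(X, ξ)V, ξ), computed from the structure equation, with the contact value yields dμ = κ(V♭ - fη)
(`der_coeff`). Since dκ = dμ/m and dV♭ = 0, the identity d(dμ) = 0 reduces to κ d(fη) = 0; as dη is
nondegenerate on the image of A, κf = 0. Differentiating κf = 0 gives κ(μ - N) = 0 and κV = 0
(`excess_mul_inner`), hence dμ = 0. Differentiating κV = 0 and tracing gives κ(r - Nd) = 0.

Tracing R(·, Y)V (`ric_field`) with Y = ξ gives f(r - Nd) = 0. Its derivative along ξ gives (μ -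
N)(r - Nd) = 0; subtracting mκ(r - Nd) = 0 leaves r = Nd (`scal_eq`). For general Y the same trace
becomes (m - 1)(QV - NV) = 0, and m ≠ 1 gives QV = NV. Finally div Ric = dr/2 = 0 applied to QV = NV
forces |Q - N|² = 0 (`ricci_eq`). The alternative on V is κV = 0 with κ constant. -/

noncomputable section

namespace RiemGeom

open Filter Topology

variable {E : Type*} [NormedAddCommGroup E] [NormedSpace ℝ E] [FiniteDimensional ℝ E]
  {H : Type*} [TopologicalSpace H] {I : ModelWithCorners ℝ E H}
  {M : Type*} [TopologicalSpace M] [ChartedSpace H M] [IsManifold I ∞ M]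

/-! ### Calculus of global smooth functions and vector fields. -/

section SmoothFields

/-- Smooth vector fields on `M`. -/
abbrev SmoothField (I : ModelWithCorners ℝ E H) (M : Type*) [TopologicalSpace M]
    [ChartedSpace H M] [IsManifold I ∞ M] :=
  ContMDiffSection I E ∞ (fun x : M ↦ TangentSpace I x)

/-- Smooth real-valued functions on `M`. -/
abbrev SmoothFun (I : ModelWithCorners ℝ E H) (M : Type*) [TopologicalSpace M]
    [ChartedSpace H M] :=
  ContMDiffMap I 𝓘(ℝ) M ℝ ∞

theorem SmoothFun.mdiffAt (f : SmoothFun I M) (x : M) : MDiffAt (f : M → ℝ) x :=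
  f.contMDiff.mdifferentiableAt (by simp)

theorem SmoothField.mdiffAt (X : SmoothField I M) (x : M) : MDiffAt (T% (X : Π _ : M, _)) x :=
  X.mdifferentiableAt

instance SmoothField.instSMul : SMul (SmoothFun I M) (SmoothField I M) :=
  ⟨fun f X ↦ ⟨(f : M → ℝ) • (X : Π _ : M, _), f.contMDiff.smul_section X.contMDiff⟩⟩

@[simp]
theorem SmoothField.smul_apply (f : SmoothFun I M) (X : SmoothField I M) (x : M) :
    (f • X) x = f x • X x := rfl

@[simp]
theorem SmoothField.add_apply (X Y : SmoothField I M) (x : M) : (X + Y) x = X x + Y x := rfl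

@[simp]
theorem SmoothField.sub_apply (X Y : SmoothField I M) (x : M) : (X - Y) x = X x - Y x := rfl

@[simp]
theorem SmoothField.neg_apply (X : SmoothField I M) (x : M) : (-X) x = -X x := rfl

@[simp]
theorem SmoothField.zero_apply (x : M) : (0 : SmoothField I M) x = 0 := rfl

@[simp]
theorem SmoothFun.add_apply (f h : SmoothFun I M) (x : M) : (f + h) x = f x + h x := rfl

@[simp]
theorem SmoothFun.mul_apply (f h : SmoothFun I M) (x : M) : (f * h) x = f x * h x := rfl

@[simp]
theorem SmoothFun.sub_apply (f h : SmoothFun I M) (x : M) : (f - h) x = f x - h x := rfl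

@[simp]
theorem SmoothFun.neg_apply (f : SmoothFun I M) (x : M) : (-f) x = -f x := rfl

@[simp]
theorem SmoothFun.one_apply (x : M) : (1 : SmoothFun I M) x = 1 := rfl

@[simp]
theorem SmoothFun.zero_apply (x : M) : (0 : SmoothFun I M) x = 0 := rfl

instance SmoothField.instModule : Module (SmoothFun I M) (SmoothField I M) where
  one_smul X := by ext x; simp
  mul_smul f h X := by ext x; simp [mul_smul]
  smul_zero f := by ext x; simp
  smul_add f X Y := by ext x; simp
  add_smul f h X := by ext x; simp [add_smul]
  zero_smul X := by ext x; simp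

/-- The constant function, as a smooth function. -/
def constFun (c : ℝ) : SmoothFun I M := ⟨fun _ ↦ c, contMDiff_const⟩

@[simp]
theorem constFun_apply (c : ℝ) (x : M) : (constFun c : SmoothFun I M) x = c := rfl

@[simp]
theorem SmoothField.sum_apply {ι : Type*} (s : Finset ι) (X : ι → SmoothField I M) (x : M) :
    (∑ i ∈ s, X i) x = ∑ i ∈ s, X i x := by
  classical
  induction s using Finset.induction_on with
  | empty => simp
  | insert i s hi h => simp [Finset.sum_insert hi, h]

@[simp]
theorem SmoothFun.sum_apply {ι : Type*} (s : Finset ι) (f : ι → SmoothFun I M) (x : M) :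
    (∑ i ∈ s, f i) x = ∑ i ∈ s, f i x := by
  classical
  induction s using Finset.induction_on with
  | empty => simp
  | insert i s hi h => simp [Finset.sum_insert hi, h]

/-- The derivative of a smooth function along a smooth vector field. -/
def der (X : SmoothField I M) (f : SmoothFun I M) : SmoothFun I M :=
  ⟨fun x ↦ mvfderiv I f x (X x), by
    have h := (f.contMDiff.contMDiff_tangentMap (m := ∞) (by simp)).comp X.contMDiff
    intro x
    have h2 := (contMDiffAt_totalSpace.1 (h x)).2
    exact h2.congr_of_eventuallyEq (.of_forall fun y ↦ by simp [mvfderiv, tangentMap]; rfl)⟩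

theorem der_apply (X : SmoothField I M) (f : SmoothFun I M) (x : M) :
    der X f x = mvfderiv I f x (X x) := rfl

/-- The Lie bracket of smooth vector fields. -/
def bracket (X Y : SmoothField I M) : SmoothField I M :=
  ⟨mlieBracket I X Y, fun x ↦ by
    have : IsManifold I (((⊤ : ℕ∞) : ℕ∞ω) + 1) M := inferInstanceAs (IsManifold I ∞ M)
    have : CompleteSpace E := FiniteDimensional.complete ℝ E
    have : IsManifold I (minSmoothness ℝ 2) M :=
      .of_le (n := ∞) (by simp only [minSmoothness_of_isRCLikeNormedField]; norm_cast)
    exact ContMDiffAt.mlieBracket_vectorField (m := ⊤) (n := ⊤) (X.contMDiff x) (Y.contMDiff x)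
      (by simp)⟩

theorem bracket_apply (X Y : SmoothField I M) (x : M) :
    bracket X Y x = mlieBracket I X Y x := rfl

theorem der_add (X : SmoothField I M) (f h : SmoothFun I M) :
    der X (f + h) = der X f + der X h := by
  ext x
  exact congrArg (· (X x)) (mvfderiv_fun_add (f.mdiffAt x) (h.mdiffAt x))

theorem der_mul (X : SmoothField I M) (f h : SmoothFun I M) :
    der X (f * h) = f * der X h + der X f * h := by
  ext x
  refine (congrArg (· (X x)) (mvfderiv_fun_mul (f.mdiffAt x) (h.mdiffAt x))).trans ?_
  simp [der_apply]
  ring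

@[simp]
theorem der_const (X : SmoothField I M) (c : ℝ) : der X (constFun c) = 0 := by
  ext x
  exact congrArg (· (X x)) (mvfderiv_const c)

theorem der_neg (X : SmoothField I M) (f : SmoothFun I M) : der X (-f) = -der X f := by
  have h : -f = constFun (-1) * f := by ext; simp
  rw [h, der_mul, der_const]
  ext
  simp

theorem der_sub (X : SmoothField I M) (f h : SmoothFun I M) :
    der X (f - h) = der X f - der X h := by
  rw [sub_eq_add_neg, der_add, der_neg, sub_eq_add_neg]

theorem der_sum {ι : Type*} (X : SmoothField I M) (s : Finset ι) (f : ι → SmoothFun I M) :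
    der X (∑ i ∈ s, f i) = ∑ i ∈ s, der X (f i) := by
  classical
  induction s using Finset.induction_on with
  | empty =>
    have h : (0 : SmoothFun I M) = constFun 0 := rfl
    simp [h]
  | insert i s hi h => rw [Finset.sum_insert hi, Finset.sum_insert hi, der_add, h]

/-- Frame identities hold only near a point; this is what allows them to be differentiated there. -/
theorem der_congr {X : SmoothField I M} {f h : SmoothFun I M} {x : M}
    (hf : (f : M → ℝ) =ᶠ[𝓝 x] h) : der X f x = der X h x := by
  simp only [der_apply, mvfderiv, hf.mfderiv_eq]
  rfl

theorem bracket_smul_right (X Y : SmoothField I M) (f : SmoothFun I M) :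
    bracket X (f • Y) = der X f • Y + f • bracket X Y := by
  ext x
  exact mlieBracket_smul_right (f.mdiffAt x) (Y.mdiffAt x)

theorem bracket_add_right (X Y Z : SmoothField I M) :
    bracket X (Y + Z) = bracket X Y + bracket X Z := by
  have : CompleteSpace E := FiniteDimensional.complete ℝ E
  ext x
  exact mlieBracket_add_right (Y.mdiffAt x) (Z.mdiffAt x)

theorem bracket_swap (X Y : SmoothField I M) : bracket X Y = -bracket Y X := by
  ext x
  exact mlieBracket_swap_apply

/-- The Jacobi identity. -/
theorem bracket_jacobi (X Y Z : SmoothField I M) :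
    bracket X (bracket Y Z) = bracket (bracket X Y) Z + bracket Y (bracket X Z) := by
  have : CompleteSpace E := FiniteDimensional.complete ℝ E
  have : IsManifold I (minSmoothness ℝ 3) M :=
    .of_le (n := ∞) (by simp only [minSmoothness_of_isRCLikeNormedField]; norm_cast)
  have hle : minSmoothness ℝ 2 ≤ ∞ := by
    simp only [minSmoothness_of_isRCLikeNormedField]; norm_cast
  ext x
  exact leibniz_identity_mlieBracket_apply ((X.contMDiff x).of_le hle)
    ((Y.contMDiff x).of_le hle) ((Z.contMDiff x).of_le hle)

/-! ### Globalizing local fields with bump functions. -/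

section Extension

variable [T2Space M]

/-- A vector field that is smooth on a neighbourhood of a point agrees near the point with a
globally smooth one. -/
theorem exists_smoothField_eventuallyEq {s : Π x : M, TangentSpace I x} {u : Set M} {x : M}
    (hs : ContMDiffOn I I.tangent ∞ (fun x ↦ (⟨x, s x⟩ : TangentBundle I M)) u) (hu : IsOpen u)
    (hx : x ∈ u) : ∃ X : SmoothField I M, ∀ᶠ y in 𝓝 x, X y = s y := by
  obtain ⟨f, -, hf⟩ :=
    (SmoothBumpFunction.nhds_basis_tsupport (I := I) x).mem_iff.1 (hu.mem_nhds hx)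
  refine ⟨⟨(f : M → ℝ) • s,
    ContMDiffOn.smul_section_of_tsupport f.contMDiff.contMDiffOn hu hf hs⟩, ?_⟩
  filter_upwards [f.eventuallyEq_one] with y hy
  simp [hy]

theorem exists_smoothField_eventuallyEq_extend {x : M} (v : TangentSpace I x) :
    ∃ X : SmoothField I M, ∀ᶠ y in 𝓝 x, X y = extend E v y := by
  let t := trivializationAt E (TangentSpace I : M → Type _) x
  refine exists_smoothField_eventuallyEq (u := t.baseSet) ?_ t.open_baseSet
    (FiberBundle.mem_baseSet_trivializationAt' x)
  rw [t.contMDiffOn_section_baseSet_iff]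
  refine (contMDiffOn_const (c := (t ⟨x, v⟩).2)).congr fun y hy ↦ ?_
  have h := congrArg Prod.snd (t.apply_mk_symm hy (t ⟨x, v⟩).2)
  exact h

theorem exists_smoothField_apply_eq {x : M} (v : TangentSpace I x) :
    ∃ X : SmoothField I M, X x = v := by
  obtain ⟨X, hX⟩ := exists_smoothField_eventuallyEq_extend v
  exact ⟨X, by simpa using hX.self_of_nhds⟩

/-- A smooth vector field that vanishes near `x` is a multiple of itself by a function that vanishes
at `x`. -/
theorem exists_eq_smul_of_eventually_eq_zero {X : SmoothField I M} {x : M}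
    (hX : ∀ᶠ y in 𝓝 x, X y = 0) : ∃ f : SmoothFun I M, f x = 0 ∧ X = f • X := by
  obtain ⟨f, -, hf⟩ := (SmoothBumpFunction.nhds_basis_tsupport (I := I) x).mem_iff.1 hX
  let h : SmoothFun I M := ⟨f, f.contMDiff⟩
  have hh : ∀ y, h y = f y := fun _ ↦ rfl
  refine ⟨1 - h, by simp [hh], ?_⟩
  ext y
  by_cases hy : y ∈ tsupport f
  · have : X y = 0 := hf hy
    simp [this]
  · have : f y = 0 := image_eq_zero_of_notMem_tsupport hy
    simp [hh, this]

/-- The commutator of the derivatives along two vector fields is the derivative along their Lie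
bracket. -/
theorem der_bracket (X Y : SmoothField I M) (f : SmoothFun I M) :
    der (bracket X Y) f = der X (der Y f) - der Y (der X f) := by
  ext x
  by_cases hX : X x = 0 ∧ Y x = 0
  · have h : bracket X Y x = 0 := by
      rw [bracket_apply, ← mlieBracketWithin_univ]
      exact mlieBracketWithin_eq_zero_of_eq_zero hX.1 hX.2
    simp [der_apply, h, hX.1, hX.2]
  · obtain ⟨Z, hZ⟩ : ∃ Z : SmoothField I M, Z x ≠ 0 := by
      by_cases h : X x = 0
      · exact ⟨Y, fun h' ↦ hX ⟨h, h'⟩⟩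
      · exact ⟨X, h⟩
    -- Expanding the Jacobi identity for X, Y, fZ and removing the one for X, Y, Z leaves the
    -- desired difference as the coefficient of Z, which does not vanish at x.
    have h := bracket_jacobi X Y (f • Z)
    simp only [bracket_smul_right, bracket_add_right] at h
    rw [bracket_jacobi X Y Z] at h
    have h' : (der X (der Y f) - der Y (der X f) - der (bracket X Y) f) • Z = 0 :=
      (by module : _ = _).trans (sub_eq_zero.2 h)
    have h'' := congrArg (fun W : SmoothField I M ↦ W x) h'
    simp only [SmoothField.smul_apply, SmoothField.zero_apply, smul_eq_zero, hZ, or_false] at h''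
    simpa using (sub_eq_zero.1 h'').symm

end Extension

end SmoothFields

/-! ### Orthonormal bases and traces at a point. -/

section Metric

variable (g : ContMDiffRiemannianMetric I ∞ E (fun x : M ↦ TangentSpace I x))

theorem inner_self_eq_zero {x : M} {v : TangentSpace I x} : g.inner x v v = 0 ↔ v = 0 := by
  refine ⟨fun h ↦ ?_, fun h ↦ by simp [h]⟩
  by_contra hv
  exact (g.pos x v hv).ne' h

theorem eq_of_forall_inner_eq {x : M} {v w : TangentSpace I x}
    (h : ∀ u, g.inner x v u = g.inner x w u) : v = w := by
  rw [← sub_eq_zero, ← inner_self_eq_zero g]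
  simp [h]

/-- The vectors `e_1, …, e_d` of the tangent space at `x` are orthonormal. -/
def IsOrthonormalAt (x : M) (e : Fin (Module.finrank ℝ E) → TangentSpace I x) : Prop :=
  ∀ i j, g.inner x (e i) (e j) = if i = j then 1 else 0

variable {g} in
theorem IsOrthonormalAt.sum_inner_smul {x : M} {e : Fin (Module.finrank ℝ E) → TangentSpace I x}
    (he : IsOrthonormalAt g x e) (v : TangentSpace I x) : ∑ i, g.inner x v (e i) • e i = v := by
  have hli : LinearIndependent ℝ e := by
    rw [Fintype.linearIndependent_iff]
    intro c hc i
    have h := congrArg (fun w ↦ g.inner x w (e i)) hc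
    simpa [map_sum, he _ _] using! h
  have hd : Fintype.card (Fin (Module.finrank ℝ E)) = Module.finrank ℝ (TangentSpace I x) :=
    Fintype.card_fin _
  have hspan : ⊤ ≤ Submodule.span ℝ (Set.range e) := by
    have : FiniteDimensional ℝ (TangentSpace I x) := inferInstanceAs (FiniteDimensional ℝ E)
    exact (hli.span_eq_top_of_card_eq_finrank' hd).ge
  obtain ⟨c, rfl⟩ := (Submodule.mem_span_range_iff_exists_fun ℝ).1
    (hspan (Submodule.mem_top (x := v)))
  refine Finset.sum_congr rfl fun i _ ↦ ?_
  congr 1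
  simp [map_sum, he _ _]

variable {g} in
/-- The trace of a bilinear form does not depend on the orthonormal basis. -/
theorem IsOrthonormalAt.sum_eq_sum {x : M} {e f : Fin (Module.finrank ℝ E) → TangentSpace I x}
    (he : IsOrthonormalAt g x e) (hf : IsOrthonormalAt g x f)
    (B : TangentSpace I x →ₗ[ℝ] TangentSpace I x →ₗ[ℝ] ℝ) :
    ∑ i, B (e i) (e i) = ∑ i, B (f i) (f i) := by
  calc ∑ i, B (e i) (e i) = ∑ i, ∑ j, g.inner x (e i) (f j) * B (f j) (e i) :=
        Finset.sum_congr rfl fun i _ ↦ by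
          simpa using (congrArg (fun w ↦ B w (e i)) (hf.sum_inner_smul (e i))).symm
    _ = ∑ j, ∑ i, g.inner x (e i) (f j) * B (f j) (e i) := Finset.sum_comm
    _ = ∑ j, B (f j) (f j) := Finset.sum_congr rfl fun j _ ↦ by
        simpa [g.symm x (f j)] using congrArg (B (f j)) (he.sum_inner_smul (f j))

variable {g} in
/-- An antisymmetric matrix pairs trivially with a symmetrized bilinear form. -/
theorem IsOrthonormalAt.sum_antisymm {x : M} {e : Fin (Module.finrank ℝ E) → TangentSpace I x}
    (he : IsOrthonormalAt g x e) (B : TangentSpace I x →ₗ[ℝ] TangentSpace I x →ₗ[ℝ] ℝ)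
    (a : Fin (Module.finrank ℝ E) → TangentSpace I x)
    (ha : ∀ i j, g.inner x (a i) (e j) + g.inner x (e i) (a j) = 0) :
    ∑ i, (B (a i) (e i) + B (e i) (a i)) = 0 := by
  have h1 : ∑ i, B (a i) (e i) = ∑ i, ∑ j, g.inner x (a i) (e j) * B (e j) (e i) :=
    Finset.sum_congr rfl fun i _ ↦ by
      conv_lhs => rw [← he.sum_inner_smul (a i)]
      simp
  have h2 : ∑ i, B (e i) (a i) = ∑ i, ∑ j, g.inner x (a i) (e j) * B (e i) (e j) :=
    Finset.sum_congr rfl fun i _ ↦ by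
      conv_lhs => rw [← he.sum_inner_smul (a i)]
      simp
  rw [Finset.sum_add_distrib, h1, h2, Finset.sum_comm, ← Finset.sum_add_distrib]
  refine Finset.sum_eq_zero fun i _ ↦ ?_
  rw [← Finset.sum_add_distrib]
  refine Finset.sum_eq_zero fun j _ ↦ ?_
  have h := ha i j
  rw [g.symm x (e i)] at h
  linear_combination B (e i) (e j) * h

/-- The inner product of smooth vector fields. -/
def ip (X Y : SmoothField I M) : SmoothFun I M :=
  ⟨fun x ↦ g.inner x (X x) (Y x), by
    let _ : RiemannianBundle (fun x : M ↦ TangentSpace I x) := ⟨g.toRiemannianMetric⟩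
    exact ContMDiff.inner_bundle (F := E) (E := fun x : M ↦ TangentSpace I x)
      (b := fun y : M ↦ y) X.contMDiff Y.contMDiff⟩

theorem ip_apply (X Y : SmoothField I M) (x : M) : ip g X Y x = g.inner x (X x) (Y x) := rfl

theorem ip_comm (X Y : SmoothField I M) : ip g X Y = ip g Y X := by
  ext x
  exact g.symm x _ _

theorem ip_add_left (X Y Z : SmoothField I M) : ip g (X + Y) Z = ip g X Z + ip g Y Z := by
  ext x
  simp [ip_apply]

theorem ip_sub_left (X Y Z : SmoothField I M) : ip g (X - Y) Z = ip g X Z - ip g Y Z := by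
  ext x
  simp [ip_apply]

theorem ip_neg_left (X Z : SmoothField I M) : ip g (-X) Z = -ip g X Z := by
  ext x
  simp [ip_apply]

theorem ip_smul_left (f : SmoothFun I M) (X Z : SmoothField I M) :
    ip g (f • X) Z = f * ip g X Z := by
  ext x
  simp [ip_apply]

theorem ip_add_right (X Y Z : SmoothField I M) : ip g X (Y + Z) = ip g X Y + ip g X Z := by
  ext x
  simp [ip_apply]

theorem ip_sub_right (X Y Z : SmoothField I M) : ip g X (Y - Z) = ip g X Y - ip g X Z := by
  ext x
  simp [ip_apply]

theorem ip_neg_right (X Z : SmoothField I M) : ip g X (-Z) = -ip g X Z := by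
  ext x
  simp [ip_apply]

theorem ip_smul_right (f : SmoothFun I M) (X Z : SmoothField I M) :
    ip g X (f • Z) = f * ip g X Z := by
  ext x
  simp [ip_apply]

/-! ### Smooth local orthonormal frames. -/

section Frame

variable [T2Space M]

/-- Near every point there is an orthonormal frame, given by globally smooth vector fields. -/
theorem exists_orthonormal_frame (x : M) :
    ∃ F : Fin (Module.finrank ℝ E) → SmoothField I M,
      ∀ᶠ y in 𝓝 x, IsOrthonormalAt g y (fun i ↦ F i y) := by
  let _ : RiemannianBundle (fun x : M ↦ TangentSpace I x) := ⟨g.toRiemannianMetric⟩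
  let t := trivializationAt E (TangentSpace I : M → Type _) x
  let b := Module.finBasis ℝ E
  let s := fun (y : M) (i : Fin (Module.finrank ℝ E)) ↦ t.localFrame b i y
  have hframe := t.isLocalFrameOn_localFrame_baseSet I ∞ b
  let G := fun (i : Fin (Module.finrank ℝ E)) (y : M) ↦
    (InnerProductSpace.gramSchmidt ℝ (s y) i : TangentSpace I y)
  have hinner : ∀ {U W : Π x : M, TangentSpace I x},
      ContMDiffOn I I.tangent ∞ (fun x ↦ (⟨x, U x⟩ : TangentBundle I M)) t.baseSet →
      ContMDiffOn I I.tangent ∞ (fun x ↦ (⟨x, W x⟩ : TangentBundle I M)) t.baseSet →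
      ContMDiffOn I 𝓘(ℝ) ∞ (fun x ↦ g.inner x (U x) (W x)) t.baseSet := fun hU hW ↦
    ContMDiffOn.inner_bundle (F := E) (E := fun x : M ↦ TangentSpace I x)
      (b := fun y : M ↦ y) hU hW
  have hne : ∀ i, ∀ y ∈ t.baseSet, G i y ≠ 0 := fun i y hy ↦
    InnerProductSpace.gramSchmidt_ne_zero i (hframe.linearIndependent hy)
  have hpos : ∀ i, ∀ y ∈ t.baseSet, 0 < g.inner y (G i y) (G i y) := fun i y hy ↦
    g.pos y _ (hne i y hy)
  have hG : ∀ i, ContMDiffOn I I.tangent ∞ (fun x ↦ (⟨x, G i x⟩ : TangentBundle I M))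
      t.baseSet := by
    intro i
    induction i using WellFoundedLT.induction with
    | ind i ih =>
      -- The Gram-Schmidt recursion writes each vector through the earlier ones, with nonvanishing
      -- denominators, so smoothness follows by strong induction.
      have hdef : ∀ y, G i y = s y i - ∑ j ∈ Finset.Iio i,
          (g.inner y (G j y) (s y i) / g.inner y (G j y) (G j y)) • G j y := fun y ↦ by
        have h := InnerProductSpace.gramSchmidt_def'' ℝ (s y) i
        have h2 : ∀ v : TangentSpace I y, g.inner y v v = ‖v‖ ^ 2 := fun v ↦
          real_inner_self_eq_norm_sq v
        simp only [h2]
        exact eq_sub_of_add_eq h.symm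
      have hsum := ContMDiffOn.sum_section (I := I) (F := E) (n := ∞)
        (V := fun x : M ↦ TangentSpace I x) (u := t.baseSet) (s := Finset.Iio i)
        (t := fun j y ↦ (g.inner y (G j y) (s y i) / g.inner y (G j y) (G j y)) • G j y)
        fun j hj ↦ ContMDiffOn.smul_section (V := fun x : M ↦ TangentSpace I x)
          ((hinner (ih j (Finset.mem_Iio.1 hj)) (hframe.contMDiffOn i)).div₀
            (hinner (ih j (Finset.mem_Iio.1 hj)) (ih j (Finset.mem_Iio.1 hj)))
            fun y hy ↦ (hpos j y hy).ne') (ih j (Finset.mem_Iio.1 hj))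
      refine ((hframe.contMDiffOn i).sub_section hsum).congr fun y _ ↦ ?_
      rw [hdef y]
      rfl
  have hN : ∀ i, ContMDiffOn I I.tangent ∞
      (fun y ↦ (⟨y, (√(g.inner y (G i y) (G i y)))⁻¹ • G i y⟩ : TangentBundle I M))
      t.baseSet := by
    intro i
    refine ContMDiffOn.smul_section (V := fun x : M ↦ TangentSpace I x) ?_ (hG i)
    intro y hy
    have h1 : ContDiffAt ℝ ∞ (fun r : ℝ ↦ (√r)⁻¹) (g.inner y (G i y) (G i y)) :=
      (Real.contDiffAt_sqrt (hpos i y hy).ne').inv (Real.sqrt_pos.2 (hpos i y hy)).ne'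
    exact ContMDiffAt.comp_contMDiffWithinAt (g := fun r : ℝ ↦ (√r)⁻¹) y h1.contMDiffAt
      (hinner (hG i) (hG i) y hy)
  choose F hF using fun i ↦ exists_smoothField_eventuallyEq (hN i) t.open_baseSet
    (FiberBundle.mem_baseSet_trivializationAt' x)
  refine ⟨F, ?_⟩
  filter_upwards [eventually_all.2 hF,
    t.open_baseSet.mem_nhds (FiberBundle.mem_baseSet_trivializationAt' x)] with y hy hyt
  intro i j
  have h := orthonormal_iff_ite.1 (InnerProductSpace.gramSchmidtNormed_orthonormal (𝕜 := ℝ)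
    (hframe.linearIndependent hyt)) i j
  simp only [hy]
  exact h

end Frame

end Metric

/-! ### Levi-Civita derivative, curvature and Ricci tensor on smooth fields. -/

section Connection

variable [T2Space M] (g : ContMDiffRiemannianMetric I ∞ E (fun x : M ↦ TangentSpace I x))

/-- Half the right-hand side of the Koszul formula, as a smooth function. -/
def koszulFun (X Y Z : SmoothField I M) : SmoothFun I M :=
  constFun (1 / 2) * (der X (ip g Y Z) + der Y (ip g X Z) - der Z (ip g X Y)
    + ip g (bracket X Y) Z - ip g (bracket X Z) Y - ip g (bracket Y Z) X)

theorem koszulFun_apply (X Y Z : SmoothField I M) (x : M) :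
    koszulFun g X Y Z x = koszul g X Y Z x := by
  simp only [koszulFun, SmoothFun.mul_apply, SmoothFun.add_apply, SmoothFun.sub_apply,
    constFun_apply]
  rw [one_div, inv_mul_eq_div]
  rfl

/-- The Levi-Civita derivative `∇_X Y` of a smooth vector field along a smooth vector field. -/
def nab (X Y : SmoothField I M) : SmoothField I M :=
  ⟨fun x ↦ leviCivita g Y x (X x), fun x ↦ by
    -- Near x the components in an orthonormal frame are the smooth Koszul expressions.
    obtain ⟨F, hF⟩ := exists_orthonormal_frame g x
    refine ((∑ i, koszulFun g X Y (F i) • F i).contMDiff x).congr_of_eventuallyEq ?_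
    filter_upwards [hF] with y hy
    congr 1
    rw [← hy.sum_inner_smul (leviCivita g Y y (X y))]
    simp only [SmoothField.sum_apply, SmoothField.smul_apply, koszulFun_apply,
      inner_leviCivita g (X.mdiffAt y) (Y.mdiffAt y) ((F _).mdiffAt y)]⟩

theorem nab_apply (X Y : SmoothField I M) (x : M) : nab g X Y x = leviCivita g Y x (X x) := rfl

theorem der_ip (X Y Z : SmoothField I M) :
    der X (ip g Y Z) = ip g (nab g X Y) Z + ip g Y (nab g X Z) := by
  ext x
  exact compatible_leviCivita g (X.mdiffAt x) (Y.mdiffAt x) (Z.mdiffAt x)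

theorem nab_sub_nab (X Y : SmoothField I M) : nab g X Y - nab g Y X = bracket X Y := by
  ext x
  exact torsion_leviCivita g (X.mdiffAt x) (Y.mdiffAt x)

theorem nab_add_left (X Y Z : SmoothField I M) : nab g (X + Y) Z = nab g X Z + nab g Y Z := by
  ext x
  simp [nab_apply]

theorem nab_sub_left (X Y Z : SmoothField I M) : nab g (X - Y) Z = nab g X Z - nab g Y Z := by
  ext x
  simp [nab_apply]

theorem nab_neg_left (X Z : SmoothField I M) : nab g (-X) Z = -nab g X Z := by
  ext x
  simp [nab_apply]

theorem nab_smul_left (f : SmoothFun I M) (X Z : SmoothField I M) :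
    nab g (f • X) Z = f • nab g X Z := by
  ext x
  simp [nab_apply]

theorem nab_add_right (X Y Z : SmoothField I M) : nab g X (Y + Z) = nab g X Y + nab g X Z := by
  ext x
  exact congrArg (· (X x)) ((leviCivita g).isCovariantDerivativeOnUniv.add (Y.mdiffAt x)
    (Z.mdiffAt x))

theorem nab_smul_right (f : SmoothFun I M) (X Z : SmoothField I M) :
    nab g X (f • Z) = f • nab g X Z + der X f • Z := by
  ext x
  have h := congrArg (· (X x)) ((leviCivita g).isCovariantDerivativeOnUniv.leibniz (Z.mdiffAt x)
    (f.mdiffAt x))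
  exact h

theorem nab_neg_right (X Z : SmoothField I M) : nab g X (-Z) = -nab g X Z := by
  have h := nab_smul_right g (constFun (-1)) X Z
  rw [der_const] at h
  have h2 : ∀ W : SmoothField I M, (constFun (-1) : SmoothFun I M) • W = -W := fun W ↦ by
    ext x; simp
  simpa [h2] using h

theorem nab_sub_right (X Y Z : SmoothField I M) : nab g X (Y - Z) = nab g X Y - nab g X Z := by
  rw [sub_eq_add_neg, nab_add_right, nab_neg_right, sub_eq_add_neg]

/-- The curvature operator `R(X, Y) Z` of smooth vector fields. -/
def curv (X Y Z : SmoothField I M) : SmoothField I M :=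
  nab g X (nab g Y Z) - nab g Y (nab g X Z) - nab g (bracket X Y) Z

theorem curv_swap (X Y Z : SmoothField I M) : curv g X Y Z = -curv g Y X Z := by
  rw [curv, curv, bracket_swap Y X, nab_neg_left]
  abel

theorem curv_add_left (X X' Y Z : SmoothField I M) :
    curv g (X + X') Y Z = curv g X Y Z + curv g X' Y Z := by
  simp only [curv, ← nab_sub_nab g, nab_add_left, nab_sub_left, nab_add_right]
  abel

theorem curv_smul_left (f : SmoothFun I M) (X Y Z : SmoothField I M) :
    curv g (f • X) Y Z = f • curv g X Y Z := by
  simp only [curv, ← nab_sub_nab g, nab_smul_left, nab_sub_left, nab_smul_right, nab_add_left]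
  module

theorem curv_add_middle (X Y Y' Z : SmoothField I M) :
    curv g X (Y + Y') Z = curv g X Y Z + curv g X Y' Z := by
  rw [curv_swap, curv_add_left, curv_swap g Y, curv_swap g Y']
  abel

theorem curv_smul_middle (f : SmoothFun I M) (X Y Z : SmoothField I M) :
    curv g X (f • Y) Z = f • curv g X Y Z := by
  rw [curv_swap, curv_smul_left, curv_swap g Y]
  module

theorem curv_add_right (X Y Z Z' : SmoothField I M) :
    curv g X Y (Z + Z') = curv g X Y Z + curv g X Y Z' := by
  simp only [curv, nab_add_right]
  abel

/-- The first derivatives of f cancel in pairs, and the second derivatives cancel by `der_bracket`.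
-/
theorem curv_smul_right (f : SmoothFun I M) (X Y Z : SmoothField I M) :
    curv g X Y (f • Z) = f • curv g X Y Z := by
  simp only [curv, nab_smul_right, nab_add_right, der_bracket]
  module

/-- The first Bianchi identity. -/
theorem curv_cyclic (X Y Z : SmoothField I M) :
    curv g X Y Z + curv g Y Z X + curv g Z X Y = 0 := by
  have h := bracket_jacobi X Y Z
  rw [bracket_swap (bracket X Y) Z, bracket_swap X Z] at h
  have hn : bracket Y (-bracket Z X) = -bracket Y (bracket Z X) := by
    simp only [← nab_sub_nab g, nab_neg_left, nab_neg_right, nab_sub_left, nab_sub_right]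
    abel
  rw [hn] at h
  simp only [← nab_sub_nab g, nab_sub_left, nab_sub_right] at h
  simp only [curv, ← nab_sub_nab g, nab_sub_left]
  rw [← sub_eq_zero] at h
  rw [← h]
  abel

/-- Metric compatibility, applied to both sides of the commutator formula for the function g(Z, W).
-/
theorem ip_curv_swap (X Y Z W : SmoothField I M) :
    ip g (curv g X Y Z) W = -ip g (curv g X Y W) Z := by
  have h := der_bracket X Y (ip g Z W)
  simp only [der_ip, der_add] at h
  simp only [curv, ip_sub_left]
  rw [ip_comm g (nab g X (nab g Y W)), ip_comm g (nab g Y (nab g X W)),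
    ip_comm g (nab g (bracket X Y) W)]
  linear_combination -h

/-- The operator `∇_X Y` at a point depends on `X` and `Y` only near that point. -/
theorem eventually_nab_eq {X Y : SmoothField I M} {s t : Π x : M, TangentSpace I x} {x : M}
    (hX : ∀ᶠ y in 𝓝 x, X y = s y) (hY : ∀ᶠ y in 𝓝 x, Y y = t y) :
    ∀ᶠ y in 𝓝 x, nab g X Y y = leviCivita g t y (s y) := by
  filter_upwards [hX, hY.eventually_nhds] with y hXy hYy
  have ht : MDiffAt (T% t) y := (Y.mdiffAt y).congr_of_eventuallyEq (by
    filter_upwards [hYy] with z hz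
    rw [hz])
  rw [nab_apply, hXy,
    (leviCivita g).isCovariantDerivativeOnUniv.congr_of_eventuallyEq (Y.mdiffAt y) ht univ_mem hYy]

/-- A map on vector fields that is linear over smooth functions only depends on the value of the
field at the point. -/
theorem eq_of_apply_eq (g : ContMDiffRiemannianMetric I ∞ E (fun x : M ↦ TangentSpace I x))
    {W : Type*} [AddCommGroup W] [Module ℝ W] {x : M}
    (Φ : SmoothField I M → W) (hadd : ∀ X Y, Φ (X + Y) = Φ X + Φ Y)
    (hsmul : ∀ (f : SmoothFun I M) X, Φ (f • X) = f x • Φ X) {X Y : SmoothField I M}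
    (h : X x = Y x) : Φ X = Φ Y := by
  obtain ⟨F, hF⟩ := exists_orthonormal_frame g x
  let Ψ : SmoothField I M →+ W := AddMonoidHom.mk' Φ hadd
  have hΨ : ∀ X, Ψ X = Φ X := fun _ ↦ rfl
  have key : ∀ X, Φ X = ∑ i, g.inner x (X x) (F i x) • Φ (F i) := fun X ↦ by
    -- The F i are orthonormal only near x, so the remainder need not vanish globally; being zero
    -- near x, it is a multiple of itself by a function vanishing at x, which Φ sends to 0.
    have hZ : ∀ᶠ y in 𝓝 x, (X - ∑ i, ip g X (F i) • F i) y = 0 := by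
      filter_upwards [hF] with y hy
      simp [ip_apply, hy.sum_inner_smul (X y)]
    obtain ⟨f, hf, hfZ⟩ := exists_eq_smul_of_eventually_eq_zero hZ
    have h0 : Φ (X - ∑ i, ip g X (F i) • F i) = 0 := by
      rw [hfZ, hsmul, hf, zero_smul]
    rw [← hΨ, map_sub, map_sum, sub_eq_zero] at h0
    rw [← hΨ X, h0]
    simp only [hΨ, hsmul, ip_apply]
  rw [key X, key Y, h]

/-- The pointwise tensor is defined through local extensions. Global fields agreeing with them near
x give the same nested derivatives, and tensoriality then allows any fields with the same values at
x. -/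
theorem riemann_apply (X Y Z : SmoothField I M) (x : M) :
    riemann g x (X x) (Y x) (Z x) = curv g X Y Z x := by
  obtain ⟨X', hX'⟩ := exists_smoothField_eventuallyEq_extend (X x)
  obtain ⟨Y', hY'⟩ := exists_smoothField_eventuallyEq_extend (Y x)
  obtain ⟨Z', hZ'⟩ := exists_smoothField_eventuallyEq_extend (Z x)
  have hX := hX'.self_of_nhds
  have hY := hY'.self_of_nhds
  have hZ := hZ'.self_of_nhds
  rw [extend_apply_self] at hX hY hZ
  have h1 : riemann g x (X x) (Y x) (Z x) = curv g X' Y' Z' x := by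
    have a1 := (eventually_nab_eq g (X := X') (Y := nab g Y' Z') (.of_forall fun _ ↦ rfl)
      (eventually_nab_eq g hY' hZ')).self_of_nhds
    have a2 := (eventually_nab_eq g (X := Y') (Y := nab g X' Z') (.of_forall fun _ ↦ rfl)
      (eventually_nab_eq g hX' hZ')).self_of_nhds
    have a3 := (eventually_nab_eq g (X := bracket X' Y')
      (s := mlieBracket I (extend E (X x)) (extend E (Y x)))
      (EventuallyEq.mlieBracket_vectorField hX' hY') hZ').self_of_nhds
    rw [riemann, curv, SmoothField.sub_apply, SmoothField.sub_apply, a1, a2, a3, hX, hY]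
  rw [h1,
    eq_of_apply_eq g (fun W ↦ curv g W Y' Z' x) (by simp [curv_add_left])
      (by simp [curv_smul_left]) hX,
    eq_of_apply_eq g (fun W ↦ curv g X W Z' x) (by simp [curv_add_middle])
      (by simp [curv_smul_middle]) hY,
    eq_of_apply_eq g (fun W ↦ curv g X Y W x) (by simp [curv_add_right])
      (by simp [curv_smul_right]) hZ]

/-- The bilinear form `(u, u') ↦ g(R(u, v) w, u')`, whose trace is `Ric(v, w)`. -/
def curvForm (x : M) (v w : TangentSpace I x) :
    TangentSpace I x →ₗ[ℝ] TangentSpace I x →ₗ[ℝ] ℝ :=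
  LinearMap.mk₂ ℝ (fun u u' ↦ g.inner x (riemann g x u v w) u')
    (fun u₁ u₂ u' ↦ by
      obtain ⟨X₁, rfl⟩ := exists_smoothField_apply_eq u₁
      obtain ⟨X₂, rfl⟩ := exists_smoothField_apply_eq u₂
      obtain ⟨Y, rfl⟩ := exists_smoothField_apply_eq v
      obtain ⟨Z, rfl⟩ := exists_smoothField_apply_eq w
      rw [← SmoothField.add_apply]
      simp only [riemann_apply]
      simp [curv_add_left])
    (fun c u u' ↦ by
      obtain ⟨X, rfl⟩ := exists_smoothField_apply_eq u
      obtain ⟨Y, rfl⟩ := exists_smoothField_apply_eq v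
      obtain ⟨Z, rfl⟩ := exists_smoothField_apply_eq w
      rw [← constFun_apply (I := I) c x, ← SmoothField.smul_apply]
      simp only [riemann_apply]
      simp [curv_smul_left])
    (fun u u₁ u₂ ↦ map_add _ _ _) (fun c u u' ↦ map_smul _ _ _)

theorem curvForm_apply (x : M) (u v w u' : TangentSpace I x) :
    curvForm g x v w u u' = g.inner x (riemann g x u v w) u' := rfl

theorem ricci_eq_sum {x : M} {e : Fin (Module.finrank ℝ E) → TangentSpace I x}
    (he : IsOrthonormalAt g x e) (v w : TangentSpace I x) :
    ricci g x v w = ∑ i, g.inner x (riemann g x (e i) v w) (e i) :=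
  IsOrthonormalAt.sum_eq_sum (inner_frame g x) he (curvForm g x v w)

/-- The Ricci tensor as a bilinear form. -/
def ricciForm (x : M) : TangentSpace I x →ₗ[ℝ] TangentSpace I x →ₗ[ℝ] ℝ :=
  LinearMap.mk₂ ℝ (ricci g x)
    (fun v₁ v₂ w ↦ by
      obtain ⟨Y₁, rfl⟩ := exists_smoothField_apply_eq v₁
      obtain ⟨Y₂, rfl⟩ := exists_smoothField_apply_eq v₂
      obtain ⟨Z, rfl⟩ := exists_smoothField_apply_eq w
      simp only [ricci, ← Finset.sum_add_distrib]
      refine Finset.sum_congr rfl fun i _ ↦ ?_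
      obtain ⟨X, hX⟩ := exists_smoothField_apply_eq (frame g x i)
      rw [← SmoothField.add_apply, ← hX]
      simp only [riemann_apply]
      simp [curv_add_middle])
    (fun c v w ↦ by
      obtain ⟨Y, rfl⟩ := exists_smoothField_apply_eq v
      obtain ⟨Z, rfl⟩ := exists_smoothField_apply_eq w
      simp only [ricci, Finset.smul_sum]
      refine Finset.sum_congr rfl fun i _ ↦ ?_
      obtain ⟨X, hX⟩ := exists_smoothField_apply_eq (frame g x i)
      rw [← constFun_apply (I := I) c x, ← SmoothField.smul_apply, ← hX]
      simp only [riemann_apply]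
      simp [curv_smul_middle])
    (fun v w₁ w₂ ↦ by
      obtain ⟨Y, rfl⟩ := exists_smoothField_apply_eq v
      obtain ⟨Z₁, rfl⟩ := exists_smoothField_apply_eq w₁
      obtain ⟨Z₂, rfl⟩ := exists_smoothField_apply_eq w₂
      simp only [ricci, ← Finset.sum_add_distrib]
      refine Finset.sum_congr rfl fun i _ ↦ ?_
      obtain ⟨X, hX⟩ := exists_smoothField_apply_eq (frame g x i)
      rw [← SmoothField.add_apply, ← hX]
      simp only [riemann_apply]
      simp [curv_add_right])
    (fun c v w ↦ by
      obtain ⟨Y, rfl⟩ := exists_smoothField_apply_eq v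
      obtain ⟨Z, rfl⟩ := exists_smoothField_apply_eq w
      simp only [ricci, Finset.smul_sum]
      refine Finset.sum_congr rfl fun i _ ↦ ?_
      obtain ⟨X, hX⟩ := exists_smoothField_apply_eq (frame g x i)
      rw [← constFun_apply (I := I) c x, ← SmoothField.smul_apply, ← hX]
      simp only [riemann_apply]
      simp [curv_smul_right])

theorem ricciForm_apply (x : M) (v w : TangentSpace I x) : ricciForm g x v w = ricci g x v w := rfl

theorem scalarCurvature_eq_sum {x : M} {e : Fin (Module.finrank ℝ E) → TangentSpace I x}
    (he : IsOrthonormalAt g x e) : scalarCurvature g x = ∑ i, ricci g x (e i) (e i) :=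
  IsOrthonormalAt.sum_eq_sum (inner_frame g x) he (ricciForm g x)

theorem eventually_ricci_eq_sum {x : M} {F : Fin (Module.finrank ℝ E) → SmoothField I M}
    (hF : ∀ᶠ y in 𝓝 x, IsOrthonormalAt g y (fun i ↦ F i y)) (Y Z : SmoothField I M) :
    ∀ᶠ y in 𝓝 x, ricci g y (Y y) (Z y) = (∑ i, ip g (curv g (F i) Y Z) (F i)) y := by
  filter_upwards [hF] with y hy
  simp [ricci_eq_sum g hy, riemann_apply, ip_apply]

/-- The Ricci tensor of smooth vector fields. -/
def ric (Y Z : SmoothField I M) : SmoothFun I M :=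
  ⟨fun x ↦ ricci g x (Y x) (Z x), fun x ↦ by
    obtain ⟨F, hF⟩ := exists_orthonormal_frame g x
    exact ((∑ i, ip g (curv g (F i) Y Z) (F i)).contMDiff x).congr_of_eventuallyEq
      (eventually_ricci_eq_sum g hF Y Z)⟩

theorem ric_apply (Y Z : SmoothField I M) (x : M) : ric g Y Z x = ricci g x (Y x) (Z x) := rfl

theorem eventually_scalarCurvature_eq_sum {x : M} {F : Fin (Module.finrank ℝ E) → SmoothField I M}
    (hF : ∀ᶠ y in 𝓝 x, IsOrthonormalAt g y (fun i ↦ F i y)) :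
    ∀ᶠ y in 𝓝 x, scalarCurvature g y = (∑ i, ric g (F i) (F i)) y := by
  filter_upwards [hF] with y hy
  simp [scalarCurvature_eq_sum g hy, ric_apply]

/-- The scalar curvature as a smooth function. -/
def scal : SmoothFun I M :=
  ⟨scalarCurvature g, fun x ↦ by
    obtain ⟨F, hF⟩ := exists_orthonormal_frame g x
    exact ((∑ i, ric g (F i) (F i)).contMDiff x).congr_of_eventuallyEq
      (eventually_scalarCurvature_eq_sum g hF)⟩

theorem scal_apply (x : M) : scal g x = scalarCurvature g x := rfl

end Connection

/-! ### Second Bianchi identity and its contraction. -/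

section Bianchi

variable [T2Space M] (g : ContMDiffRiemannianMetric I ∞ E (fun x : M ↦ TangentSpace I x))

/-- The covariant derivative `(∇_X R)(Y, Z) W` of the curvature. -/
def nabCurv (X Y Z W : SmoothField I M) : SmoothField I M :=
  nab g X (curv g Y Z W) - curv g (nab g X Y) Z W - curv g Y (nab g X Z) W
    - curv g Y Z (nab g X W)

theorem curv_nab_sub (X Y Z W : SmoothField I M) :
    curv g (nab g X Y) Z W = curv g (nab g Y X) Z W + curv g (bracket X Y) Z W := by
  rw [← curv_add_left, ← nab_sub_nab g, add_sub_cancel]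

/-- The second Bianchi identity. -/
theorem nabCurv_cyclic (X Y Z W : SmoothField I M) :
    nabCurv g X Y Z W + nabCurv g Y Z X W + nabCurv g Z X Y W = 0 := by
  have h : nab g (bracket (bracket X Y) Z) W + nab g (bracket (bracket Y Z) X) W
      + nab g (bracket (bracket Z X) Y) W = 0 := by
    have hj := bracket_jacobi X Y Z
    rw [bracket_swap X (bracket Y Z), bracket_swap X Z, bracket_swap Y (-bracket Z X)] at hj
    have hn : bracket (-bracket Z X) Y = -bracket (bracket Z X) Y := by
      simp only [← nab_sub_nab g, nab_neg_left, nab_neg_right, nab_sub_left, nab_sub_right]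
      abel
    rw [hn, neg_neg] at hj
    rw [← nab_add_left, ← nab_add_left, add_assoc, add_comm (bracket (bracket Y Z) X), ← add_assoc,
      ← hj, neg_add_cancel]
    ext x
    simp [nab_apply]
  have h1 := curv_nab_sub g X Y Z W
  have h2 := curv_nab_sub g Y Z X W
  have h3 := curv_nab_sub g Z X Y W
  simp only [nabCurv, curv_swap g Y (nab g X Z), curv_swap g Z (nab g Y X),
    curv_swap g X (nab g Z Y), h1, h2, h3]
  simp only [curv, nab_sub_right]
  rw [← h]
  abel

theorem ip_nabCurv (X Y Z W U : SmoothField I M) :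
    ip g (nabCurv g X Y Z W) U = der X (ip g (curv g Y Z W) U) - ip g (curv g (nab g X Y) Z W) U
      - ip g (curv g Y (nab g X Z) W) U - ip g (curv g Y Z (nab g X W)) U
      - ip g (curv g Y Z W) (nab g X U) := by
  simp only [nabCurv, ip_sub_left, der_ip]
  ring

theorem ip_nabCurv_swap_right (X Y Z W U : SmoothField I M) :
    ip g (nabCurv g X Y Z W) U = -ip g (nabCurv g X Y Z U) W := by
  rw [ip_nabCurv, ip_nabCurv, ip_curv_swap g Y Z W U, ip_curv_swap g (nab g X Y) Z W U,
    ip_curv_swap g Y (nab g X Z) W U, ip_curv_swap g Y Z (nab g X W) U,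
    ip_curv_swap g Y Z W (nab g X U), der_neg]
  ring

theorem nabCurv_swap_left (X Y Z W : SmoothField I M) :
    nabCurv g X Y Z W = -nabCurv g X Z Y W := by
  simp only [nabCurv]
  rw [curv_swap g Y Z W, curv_swap g (nab g X Y) Z W, curv_swap g Y (nab g X Z) W,
    curv_swap g Y Z (nab g X W), nab_neg_right]
  abel

/-- The covariant derivative `(∇_X Ric)(Y, Z)` of the Ricci tensor. -/
def nabRic (X Y Z : SmoothField I M) : SmoothFun I M :=
  der X (ric g Y Z) - ric g (nab g X Y) Z - ric g Y (nab g X Z)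

-- Differentiate the locally constant functions g(F i, F j).
variable {g} in
theorem inner_nab_frame_antisymm {x : M} {F : Fin (Module.finrank ℝ E) → SmoothField I M}
    (hF : ∀ᶠ y in 𝓝 x, IsOrthonormalAt g y (fun i ↦ F i y)) (X : SmoothField I M)
    (i j : Fin (Module.finrank ℝ E)) :
    g.inner x (nab g X (F i) x) (F j x) + g.inner x (F i x) (nab g X (F j) x) = 0 := by
  have h : der X (ip g (F i) (F j)) x = der X (constFun (if i = j then 1 else 0)) x :=
    der_congr (by filter_upwards [hF] with y hy using hy i j)
  rw [der_ip, der_const] at h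
  exact h

-- Covariant differentiation commutes with the trace: the terms where the frame itself is
-- differentiated have an antisymmetric coefficient matrix and cancel.
variable {g} in
theorem nabRic_eq_sum {x : M} {F : Fin (Module.finrank ℝ E) → SmoothField I M}
    (hF : ∀ᶠ y in 𝓝 x, IsOrthonormalAt g y (fun i ↦ F i y)) (X Y Z : SmoothField I M) :
    nabRic g X Y Z x = ∑ i, ip g (nabCurv g X (F i) Y Z) (F i) x := by
  have h1 : der X (ric g Y Z) x = der X (∑ i, ip g (curv g (F i) Y Z) (F i)) x :=
    der_congr (eventually_ricci_eq_sum g hF Y Z)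
  have h2 : ric g (nab g X Y) Z x = _ := (eventually_ricci_eq_sum g hF (nab g X Y) Z).self_of_nhds
  have h3 : ric g Y (nab g X Z) x = _ := (eventually_ricci_eq_sum g hF Y (nab g X Z)).self_of_nhds
  have h4 := hF.self_of_nhds.sum_antisymm (curvForm g x (Y x) (Z x)) (fun i ↦ nab g X (F i) x)
    (inner_nab_frame_antisymm hF X)
  simp only [curvForm_apply, riemann_apply, ← ip_apply, Finset.sum_add_distrib] at h4
  simp only [nabRic, SmoothFun.sub_apply, h1, h2, h3, der_sum, ip_nabCurv, SmoothFun.sum_apply,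
    Finset.sum_sub_distrib]
  linear_combination h4

variable {g} in
theorem der_scal_eq_sum {x : M} {F : Fin (Module.finrank ℝ E) → SmoothField I M}
    (hF : ∀ᶠ y in 𝓝 x, IsOrthonormalAt g y (fun i ↦ F i y)) (X : SmoothField I M) :
    der X (scal g) x = ∑ i, nabRic g X (F i) (F i) x := by
  have h1 : der X (scal g) x = der X (∑ i, ric g (F i) (F i)) x :=
    der_congr (eventually_scalarCurvature_eq_sum g hF)
  have h4 := hF.self_of_nhds.sum_antisymm (ricciForm g x) (fun i ↦ nab g X (F i) x)
    (inner_nab_frame_antisymm hF X)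
  simp only [ricciForm_apply, ← ric_apply, Finset.sum_add_distrib] at h4
  simp only [nabRic, h1, der_sum, SmoothFun.sub_apply, SmoothFun.sum_apply,
    Finset.sum_sub_distrib]
  linear_combination h4

variable {g} in
/-- The contracted second Bianchi identity `div Ric = dr / 2`. -/
theorem der_scal_eq_two_mul_sum {x : M} {F : Fin (Module.finrank ℝ E) → SmoothField I M}
    (hF : ∀ᶠ y in 𝓝 x, IsOrthonormalAt g y (fun i ↦ F i y)) (Y : SmoothField I M) :
    der Y (scal g) x = 2 * ∑ i, nabRic g (F i) Y (F i) x := by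
  -- The second Bianchi identity, with the two skew symmetries used so that, summed over i and j,
  -- both right-hand terms give the same divergence.
  have key : ∀ i j, ip g (nabCurv g Y (F i) (F j) (F j)) (F i) x
      = ip g (nabCurv g (F i) (F j) Y (F i)) (F j) x
        + ip g (nabCurv g (F j) (F i) Y (F j)) (F i) x := fun i j ↦ by
    have h := congrArg (fun W ↦ ip g W (F i) x) (nabCurv_cyclic g Y (F i) (F j) (F j))
    rw [nabCurv_swap_left g (F j) Y (F i)] at h
    simp only [ip_add_left, ip_neg_left, SmoothFun.add_apply, SmoothFun.neg_apply] at h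
    rw [ip_nabCurv_swap_right g (F i) (F j) Y (F j) (F i)] at h
    simp only [SmoothFun.neg_apply] at h
    have h0 : ip g 0 (F i) x = 0 := by simp [ip_apply]
    rw [h0] at h
    linear_combination h
  rw [der_scal_eq_sum hF]
  simp only [nabRic_eq_sum hF, key, Finset.sum_add_distrib]
  rw [Finset.sum_comm, two_mul]

end Bianchi

/-! ### Curvature of a K-contact manifold. -/

section KContact

variable (g : ContMDiffRiemannianMetric I ∞ E (fun x : M ↦ TangentSpace I x))

theorem lieDerivMetric_eq {V : Π x : M, TangentSpace I x} {x : M} (hV : MDiffAt (T% V) x)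
    (u w : TangentSpace I x) :
    lieDerivMetric g V x u w =
      g.inner x (leviCivita g V x u) w + g.inner x u (leviCivita g V x w) := by
  have hu := mdifferentiableAt_extend I E (x := x) u
  have hw := mdifferentiableAt_extend I E (x := x) w
  rw [lieDerivMetric, compatible_leviCivita g hV hu hw, ← torsion_leviCivita g hV hu,
    ← torsion_leviCivita g hV hw]
  simp only [extend_apply_self, map_sub, sub_apply]
  ring

theorem extDerivOneForm_flat_eq {V : Π x : M, TangentSpace I x} {x : M} (hV : MDiffAt (T% V) x)
    (u v : TangentSpace I x) :
    extDerivOneForm (flat g V) x u v =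
      (g.inner x (leviCivita g V x u) v - g.inner x (leviCivita g V x v) u) / 2 := by
  have hu := mdifferentiableAt_extend I E (x := x) u
  have hv := mdifferentiableAt_extend I E (x := x) v
  have h1 := compatible_leviCivita g hu hV hv
  have h2 := compatible_leviCivita g hv hV hu
  simp only [extend_apply_self] at h1 h2
  simp only [extDerivOneForm, flat]
  rw [h1, h2, ← torsion_leviCivita g hu hv]
  simp only [extend_apply_self, map_sub]
  ring

theorem IsOrthonormalAt.sum_inner_mul_inner {x : M}
    {e : Fin (Module.finrank ℝ E) → TangentSpace I x}
    (he : IsOrthonormalAt g x e) (v w : TangentSpace I x) :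
    ∑ i, g.inner x v (e i) * g.inner x w (e i) = g.inner x v w := by
  conv_rhs => rw [← he.sum_inner_smul w]
  simp [mul_comm]

theorem IsContactMetric.eta_eq_flat {φ : Π x : M, TangentSpace I x →L[ℝ] TangentSpace I x}
    {ξ : Π x : M, TangentSpace I x} {η : Π x : M, TangentSpace I x →L[ℝ] ℝ}
    (h : IsContactMetric g φ ξ η) : η = flat g ξ := by
  funext x
  ext u
  rw [h.η_eq, g.symm]
  rfl

variable [T2Space M]

/-- `ξ` is a unit Killing vector field whose covariant derivative `-φ = ∇ξ` squares to
`-1 + η ⊗ ξ`. -/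
structure IsReebField (ξ : SmoothField I M) : Prop where
  unit : ip g ξ ξ = 1
  killing : ∀ X Y, ip g (nab g X ξ) Y = -ip g X (nab g Y ξ)
  sq : ∀ X, nab g (nab g X ξ) ξ = -X + ip g X ξ • ξ

-- For a Killing field dη(v, u) = -g(∇_u ξ, v), so the contact condition says φ = -∇ξ. From here on
-- φ and η are replaced by ∇ξ and g(·, ξ).
variable {g} in
theorem IsKContact.isReebField {φ : Π x : M, TangentSpace I x →L[ℝ] TangentSpace I x}
    {ξ : Π x : M, TangentSpace I x} {η : Π x : M, TangentSpace I x →L[ℝ] ℝ}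
    (h : IsKContact g φ ξ η) : IsReebField g ⟨ξ, h.smooth_ξ⟩ := by
  have hd : ∀ x : M, MDiffAt (T% ξ) x := fun x ↦
    SmoothField.mdiffAt (⟨ξ, h.smooth_ξ⟩ : SmoothField I M) x
  have hkill : ∀ (x : M) (u v : TangentSpace I x),
      g.inner x (leviCivita g ξ x u) v = -g.inner x u (leviCivita g ξ x v) := fun x u v ↦ by
    have h1 := h.killing x u v
    rw [lieDerivMetric_eq g (hd x)] at h1
    linear_combination h1
  have hφ : ∀ (x : M) (u : TangentSpace I x), leviCivita g ξ x u = -φ x u := fun x u ↦ by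
    refine eq_of_forall_inner_eq g fun v ↦ ?_
    have h1 := h.dη_eq x v u
    rw [h.toIsContactMetric.eta_eq_flat, extDerivOneForm_flat_eq g (hd x), hkill,
      g.symm x v (leviCivita g ξ x u)] at h1
    rw [map_neg, neg_apply, g.symm x (φ x u), ← h1]
    ring
  refine ⟨?_, fun X Y ↦ ?_, fun X ↦ ?_⟩
  · ext x
    exact h.unit_ξ x
  · ext x
    exact hkill x (X x) (Y x)
  · ext x
    refine (hφ x _).trans ?_
    rw [nab_apply]
    change -φ x (leviCivita g ξ x (X x)) = -X x + g.inner x (X x) (ξ x) • ξ x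
    rw [hφ, map_neg, neg_neg, h.φ_sq, h.η_eq]

namespace IsReebField

variable {g} {ξ : SmoothField I M} (h : IsReebField g ξ)
include h

theorem ip_nab_self (X : SmoothField I M) : ip g (nab g X ξ) X = 0 := by
  have h1 := h.killing X X
  rw [ip_comm g X] at h1
  ext x
  have h2 := DFunLike.congr_fun h1 x
  simp only [SmoothFun.neg_apply] at h2
  simp only [SmoothFun.zero_apply]
  linarith

theorem ip_nab_reeb (X : SmoothField I M) : ip g (nab g X ξ) ξ = 0 := by
  have h1 := der_ip g X ξ ξ
  have h0 : (1 : SmoothFun I M) = constFun 1 := rfl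
  rw [h.unit, h0, der_const, ip_comm g ξ] at h1
  ext x
  have h2 := DFunLike.congr_fun h1 x
  simp only [SmoothFun.add_apply, SmoothFun.zero_apply] at h2
  simp only [SmoothFun.zero_apply]
  linarith

/-- By skewness |Aξ|² = -g(ξ, A²ξ), and A²ξ = -ξ + ξ = 0. -/
theorem nab_reeb_self : nab g ξ ξ = 0 := by
  have h1 := h.killing ξ (nab g ξ ξ)
  rw [h.sq, ip_add_right, ip_neg_right, ip_smul_right, h.unit] at h1
  ext x
  rw [SmoothField.zero_apply, ← inner_self_eq_zero g, ← ip_apply, h1]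
  simp

/-- `R(X, Y) ξ` is the antisymmetrized covariant derivative of the endomorphism field `∇ξ`. -/
theorem curv_reeb (X Y : SmoothField I M) :
    curv g X Y ξ = (nab g X (nab g Y ξ) - nab g (nab g X Y) ξ)
      - (nab g Y (nab g X ξ) - nab g (nab g Y X) ξ) := by
  rw [curv, ← nab_sub_nab g, nab_sub_left]
  abel

/-- The covariant derivative of the skew endomorphism A is again skew. -/
theorem ip_nab_nab_swap (X Y Z : SmoothField I M) :
    ip g (nab g X (nab g Y ξ) - nab g (nab g X Y) ξ) Z
      = -ip g (nab g X (nab g Z ξ) - nab g (nab g X Z) ξ) Y := by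
  have h1 := congrArg (der X) (h.killing Y Z)
  rw [der_neg, der_ip, der_ip] at h1
  have h2 := h.killing Y (nab g X Z)
  have h3 := h.killing (nab g X Y) Z
  simp only [ip_sub_left]
  rw [ip_comm g (nab g X (nab g Z ξ)), ip_comm g (nab g (nab g X Z) ξ)]
  linear_combination h1 - h2 - h3

/-- The classical identity for Killing fields: since R(X, Y)ξ antisymmetrizes ∇A and ∇A is skew, the
first Bianchi identity isolates the single term (∇_Z A)X. -/
theorem ip_curv_reeb (X Y Z : SmoothField I M) :
    ip g (curv g X Y ξ) Z = -ip g (nab g Z (nab g X ξ) - nab g (nab g Z X) ξ) Y := by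
  have hc := congrArg (fun W ↦ ip g W ξ) (curv_cyclic g X Y Z)
  have h0 : ip g 0 ξ = 0 := by ext; simp [ip_apply]
  simp only [ip_add_left, h0] at hc
  rw [ip_curv_swap g X Y Z, ip_curv_swap g Y Z X, ip_curv_swap g Z X Y] at hc
  simp only [h.curv_reeb, ip_sub_left _ (_ - _) (_ - _)] at hc ⊢
  have s1 := h.ip_nab_nab_swap X Y Z
  have s2 := h.ip_nab_nab_swap Y X Z
  have s3 := h.ip_nab_nab_swap Z X Y
  ext x
  replace hc := DFunLike.congr_fun hc x
  replace s1 := DFunLike.congr_fun s1 x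
  replace s2 := DFunLike.congr_fun s2 x
  replace s3 := DFunLike.congr_fun s3 x
  simp only [SmoothFun.add_apply, SmoothFun.sub_apply, SmoothFun.neg_apply,
    SmoothFun.zero_apply] at hc s1 s2 s3 ⊢
  linarith

/-- Differentiating g(AX, ξ) = 0 along Z turns the right side of `ip_curv_reeb` into g(AX, AZ). -/
theorem ip_curv_reeb_reeb (X Z : SmoothField I M) :
    ip g (curv g X ξ ξ) Z = ip g X Z - ip g X ξ * ip g Z ξ := by
  rw [h.ip_curv_reeb, ip_sub_left, h.ip_nab_reeb]
  have h1 := congrArg (der Z) (h.ip_nab_reeb X)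
  rw [der_ip, h.killing X (nab g Z ξ), h.sq, ip_add_right, ip_neg_right, ip_smul_right] at h1
  have h0 : (0 : SmoothFun I M) = constFun 0 := rfl
  rw [h0, der_const] at h1
  linear_combination -h1

/-- The covariant derivative along X of A² = -1 + η ⊗ ξ, with ∇A rewritten as curvature. -/
theorem ip_curv_reeb_nab (X Y Z : SmoothField I M) :
    ip g (curv g Y (nab g Z ξ) ξ) X - ip g (curv g (nab g Y ξ) Z ξ) X
      = ip g (nab g X ξ) Y * ip g Z ξ + ip g Y ξ * ip g (nab g X ξ) Z := by
  rw [h.ip_curv_reeb, h.ip_curv_reeb]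
  have h1 := congrArg (fun W ↦ ip g (nab g X W) Z) (h.sq Y)
  simp only [nab_add_right, nab_neg_right, nab_smul_right, ip_add_left, ip_neg_left,
    ip_smul_left, der_ip, ip_comm g ξ Z] at h1
  have h2 := congrArg (fun W ↦ ip g W Z) (h.sq (nab g X Y))
  simp only [ip_add_left, ip_neg_left, ip_smul_left, ip_comm g ξ Z] at h2
  have h3 := h.killing (nab g X (nab g Y ξ) - nab g (nab g X Y) ξ) Z
  simp only [nab_sub_left, ip_sub_left] at h3
  simp only [ip_sub_left]
  rw [ip_comm g (nab g X ξ) Y]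
  linear_combination h1 - h2 - h3

/-- A Reeb field spans an eigenspace of the Ricci tensor. -/
theorem ric_reeb (Y : SmoothField I M) :
    ric g Y ξ = constFun ((Module.finrank ℝ E : ℝ) - 1) * ip g Y ξ := by
  ext x
  obtain ⟨F, hF⟩ := exists_orthonormal_frame g x
  have he := hF.self_of_nhds
  have hric : ∀ Y : SmoothField I M, ric g Y ξ x = ∑ i, ip g (curv g (F i) Y ξ) (F i) x :=
    fun Y ↦ (eventually_ricci_eq_sum g hF Y ξ).self_of_nhds.trans (SmoothFun.sum_apply _ _ _)
  have hξ : ric g ξ ξ x = (Module.finrank ℝ E : ℝ) - 1 := by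
    have h1 : ∀ i, ip g (F i) (F i) x = 1 := fun i ↦ by simpa [ip_apply] using he i i
    have h2 : ∑ i, ip g (F i) ξ x * ip g (F i) ξ x = ip g ξ ξ x := by
      have := he.sum_inner_mul_inner g (ξ x) (ξ x)
      simpa only [ip_apply, g.symm x (ξ x)] using this
    simp only [hric, h.ip_curv_reeb_reeb, SmoothFun.sub_apply, SmoothFun.mul_apply,
      Finset.sum_sub_distrib, h1, h2, h.unit]
    simp
  -- Together with the value on ξ this suffices, since Y = -A(AY) + η(Y)ξ. The formula for moving A
  -- across the curvature reduces the claim to the vanishing of ∑ g(R(AFᵢ, W)ξ, Fᵢ).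
  have hφ : ∀ W : SmoothField I M, ric g (nab g W ξ) ξ x = 0 := fun W ↦ by
    have hanti : ∀ i j, g.inner x (nab g (F i) ξ x) (F j x)
        + g.inner x (F i x) (nab g (F j) ξ x) = 0 := fun i j ↦ by
      have := DFunLike.congr_fun (h.killing (F i) (F j)) x
      simp only [ip_apply, SmoothFun.neg_apply] at this
      rw [this, neg_add_cancel]
    have hz : ∑ i, ip g (nab g W ξ) (F i) x * ip g ξ (F i) x = 0 :=
      (he.sum_inner_mul_inner g _ _).trans
        (DFunLike.congr_fun (h.ip_nab_reeb W) x)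
    have t1 : ∑ i, ip g (curv g (nab g (F i) ξ) (F i) ξ) W x = 0 := by
      have hr : ∀ i, 2 * ip g (curv g (nab g (F i) ξ) (F i) ξ) W x
          = -2 * (ip g (nab g W ξ) (F i) x * ip g ξ (F i) x) := fun i ↦ by
        have := DFunLike.congr_fun (h.ip_curv_reeb_nab W (F i) (F i)) x
        rw [curv_swap g (F i), ip_neg_left, ip_comm g (F i) ξ] at this
        simp only [SmoothFun.sub_apply, SmoothFun.neg_apply, SmoothFun.add_apply,
          SmoothFun.mul_apply] at this
        linear_combination -this
      have := Finset.sum_congr (s₁ := Finset.univ) rfl fun i _ ↦ hr i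
      rw [← Finset.mul_sum, ← Finset.mul_sum, hz] at this
      linarith
    have t2 := he.sum_antisymm (curvForm g x (W x) (ξ x)) (fun i ↦ nab g (F i) ξ x) hanti
    simp only [curvForm_apply, riemann_apply, ← ip_apply, Finset.sum_add_distrib] at t2
    -- Let S₁ be this sum and S₂ the one with A moved to the last slot. Skewness of A gives S₁ + S₂
    -- = 0 (`t2`), while the first Bianchi identity with `t1` gives S₁ = S₂.
    have t3 : ∑ i, ip g (curv g (nab g (F i) ξ) W ξ) (F i) x = 0 := by
      have hb : ∀ i, ip g (curv g (nab g (F i) ξ) W ξ) (F i) x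
          = ip g (curv g (nab g (F i) ξ) (F i) ξ) W x
            + ip g (curv g (F i) W ξ) (nab g (F i) ξ) x := fun i ↦ by
        have hc := congrArg (fun U ↦ ip g U ξ x) (curv_cyclic g (F i) W (nab g (F i) ξ))
        have h0 : ip g 0 ξ x = 0 := by simp [ip_apply]
        simp only [ip_add_left, SmoothFun.add_apply, h0] at hc
        rw [ip_curv_swap g (F i), ip_curv_swap g W, ip_curv_swap g (nab g (F i) ξ),
          curv_swap g W, ip_neg_left] at hc
        simp only [SmoothFun.neg_apply] at hc
        linear_combination hc
      simp only [hb, Finset.sum_add_distrib, t1] at t2 ⊢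
      linarith
    have hb : ∀ i, ip g (curv g (F i) (nab g W ξ) ξ) (F i) x
        = ip g (curv g (nab g (F i) ξ) W ξ) (F i) x
          - ip g (nab g W ξ) (F i) x * ip g ξ (F i) x := fun i ↦ by
      have := DFunLike.congr_fun (h.ip_curv_reeb_nab (F i) (F i) W) x
      rw [h.ip_nab_self, h.killing (F i) W, ip_comm g (F i) (nab g W ξ), ip_comm g (F i) ξ] at this
      simp only [SmoothFun.sub_apply, SmoothFun.neg_apply, SmoothFun.add_apply,
        SmoothFun.mul_apply, SmoothFun.zero_apply] at this
      linear_combination this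
    simp only [hric, hb, Finset.sum_sub_distrib, t3, hz, sub_zero]
  have hY : Y = -nab g (nab g Y ξ) ξ + ip g Y ξ • ξ := by
    rw [h.sq]
    abel
  have h1 := hφ (nab g Y ξ)
  rw [ric_apply] at h1 hξ ⊢
  rw [← ricciForm_apply] at h1 hξ ⊢
  have h2 : Y x = -nab g (nab g Y ξ) ξ x + ip g Y ξ x • ξ x :=
    congrArg (fun W : SmoothField I M ↦ W x) hY
  conv_lhs => rw [h2]
  simp only [map_add, map_neg, map_smul, LinearMap.add_apply, LinearMap.neg_apply,
    LinearMap.smul_apply, h1, hξ]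
  simp [mul_comm]

end IsReebField

end KContact

/-! ### Closed quasi-Einstein fields. -/

section QuasiEinstein

variable [T2Space M] (g : ContMDiffRiemannianMetric I ∞ E (fun x : M ↦ TangentSpace I x))

theorem der_const_mul (X : SmoothField I M) (c : ℝ) (f : SmoothFun I M) :
    der X (constFun c * f) = constFun c * der X f := by
  rw [der_mul, der_const, zero_mul, add_zero]

theorem ric_add_right (X Y Z : SmoothField I M) : ric g X (Y + Z) = ric g X Y + ric g X Z := by
  ext x
  exact map_add (ricciForm g x (X x)) (Y x) (Z x)

theorem ric_sub_right (X Y Z : SmoothField I M) : ric g X (Y - Z) = ric g X Y - ric g X Z := by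
  ext x
  exact map_sub (ricciForm g x (X x)) (Y x) (Z x)

theorem ric_smul_right (f : SmoothFun I M) (X Z : SmoothField I M) :
    ric g X (f • Z) = f * ric g X Z := by
  ext x
  exact map_smul (ricciForm g x (X x)) (f x) (Z x)

theorem ric_sub_left (X Y Z : SmoothField I M) : ric g (X - Y) Z = ric g X Z - ric g Y Z := by
  ext x
  exact LinearMap.map_sub₂ (ricciForm g x) (X x) (Y x) (Z x)

theorem sum_ip_mul_ip {x : M} {F : Fin (Module.finrank ℝ E) → SmoothField I M}
    (he : IsOrthonormalAt g x (fun i ↦ F i x)) (Y Z : SmoothField I M) :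
    ∑ i, ip g Y (F i) x * ip g Z (F i) x = ip g Y Z x :=
  he.sum_inner_mul_inner g _ _

theorem sum_ip_mul_ric {x : M} {F : Fin (Module.finrank ℝ E) → SmoothField I M}
    (he : IsOrthonormalAt g x (fun i ↦ F i x)) (Y Z : SmoothField I M) :
    ∑ i, ip g Z (F i) x * ric g Y (F i) x = ric g Y Z x := by
  have h := congrArg (ricciForm g x (Y x)) (he.sum_inner_smul (Z x))
  simpa using! h

/-- The field `V` satisfies `∇V = μ + V♭ ⊗ V / m - Ric` with `μ = lam + ρ r`, and `∇V` is
symmetric. -/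
structure IsQuasiEinsteinField (m ρ lam : ℝ) (V : SmoothField I M) : Prop where
  m_pos : 0 < m
  closed : ∀ X Y, ip g (nab g X V) Y = ip g (nab g Y V) X
  equation : ∀ X Y, ip g (nab g X V) Y = (constFun lam + constFun ρ * scal g) * ip g X Y
    + constFun (1 / m) * (ip g V X * ip g V Y) - ric g X Y

variable {g} in
theorem IsClosedQuasiEinstein.isQuasiEinsteinField {m ρ lam : ℝ} {V : Π x : M, TangentSpace I x}
    (h : IsClosedQuasiEinstein g m ρ lam V) :
    IsQuasiEinsteinField g m ρ lam ⟨V, h.smooth_V⟩ := by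
  have hd : ∀ x : M, MDiffAt (T% V) x := fun x ↦
    SmoothField.mdiffAt (⟨V, h.smooth_V⟩ : SmoothField I M) x
  have hc : ∀ (x : M) (u v : TangentSpace I x),
      g.inner x (leviCivita g V x u) v = g.inner x (leviCivita g V x v) u := fun x u v ↦ by
    have h1 := h.closed x u v
    rw [extDerivOneForm_flat_eq g (hd x)] at h1
    linarith
  refine ⟨h.m_pos, fun X Y ↦ ?_, fun X Y ↦ ?_⟩
  · ext x
    exact hc x (X x) (Y x)
  · ext x
    have h1 := h.equation x (X x) (Y x)
    rw [lieDerivMetric_eq g (hd x), g.symm x (X x) (leviCivita g V x (Y x)),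
      ← hc x (X x) (Y x)] at h1
    change g.inner x (leviCivita g V x (X x)) (Y x) =
      (lam + ρ * scalarCurvature g x) * g.inner x (X x) (Y x)
        + 1 / m * (flat g V x (X x) * flat g V x (Y x)) - ricci g x (X x) (Y x)
    linarith

variable {g}

namespace IsQuasiEinsteinField

variable {m ρ lam : ℝ} {V : SmoothField I M}

/-- Every other term of the structure equation is symmetric, so the pair symmetry of the curvature
is not needed. -/
theorem ric_comm (h : IsQuasiEinsteinField g m ρ lam V) (X Y : SmoothField I M) :
    ric g X Y = ric g Y X := by
  have h1 := h.equation X Y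
  rw [h.closed, h.equation, ip_comm g Y X] at h1
  linear_combination h1

theorem nabRic_comm (h : IsQuasiEinsteinField g m ρ lam V) (X Y Z : SmoothField I M) :
    nabRic g X Y Z = nabRic g X Z Y := by
  rw [nabRic, nabRic, h.ric_comm Y Z, h.ric_comm (nab g X Y), h.ric_comm Y]
  ring

/-- The Codazzi-type equation satisfied by a closed quasi-Einstein field. -/
theorem ip_curv (h : IsQuasiEinsteinField g m ρ lam V) {μ : SmoothFun I M}
    (hμ : μ = constFun lam + constFun ρ * scal g) (X Y Z : SmoothField I M) :
    ip g (curv g X Y V) Z = der X μ * ip g Y Z - der Y μ * ip g X Z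
      + constFun (1 / m) * (ip g V Y * (μ * ip g X Z - ric g X Z)
        - ip g V X * (μ * ip g Y Z - ric g Y Z)) - nabRic g X Y Z + nabRic g Y X Z := by
  have he := h.equation
  simp only [← hμ] at he
  have h1 : ∀ X Y : SmoothField I M, ip g (nab g X (nab g Y V)) Z =
      der X (ip g (nab g Y V) Z) - ip g (nab g Y V) (nab g X Z) := fun X Y ↦ by
    rw [der_ip]
    ring
  have hc := h.closed X Y
  rw [curv, ip_sub_left, ip_sub_left, h1, h1, ← nab_sub_nab g]
  simp only [he, der_sub, der_add, der_mul, der_const, der_ip, ip_sub_left, ip_sub_right,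
    ric_sub_left, nabRic] at hc ⊢
  linear_combination constFun (1 / m) * ip g V Z * hc

/-! ### Quasi-Einstein fields in the presence of a Reeb field. -/

section Reeb

variable {ξ : SmoothField I M} (hξ : IsReebField g ξ) (h : IsQuasiEinsteinField g m ρ lam V)
include hξ h

theorem nabRic_reeb (X Y : SmoothField I M) :
    nabRic g X Y ξ = constFun ((Module.finrank ℝ E : ℝ) - 1) * ip g Y (nab g X ξ)
      - ric g Y (nab g X ξ) := by
  rw [nabRic, hξ.ric_reeb, hξ.ric_reeb, der_const_mul, der_ip]
  ring

/-- By the contracted Bianchi identity ξr/2 is the trace of (∇Ric)(ξ, ·), which pairs the skew A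
with the symmetric tensors g and Ric. -/
theorem der_reeb_scal : der ξ (scal g) = 0 := by
  ext x
  obtain ⟨F, hF⟩ := exists_orthonormal_frame g x
  have he := hF.self_of_nhds
  have hanti : ∀ i j, g.inner x (nab g (F i) ξ x) (F j x)
      + g.inner x (F i x) (nab g (F j) ξ x) = 0 := fun i j ↦ by
    have := DFunLike.congr_fun (hξ.killing (F i) (F j)) x
    simp only [ip_apply, SmoothFun.neg_apply] at this
    rw [this, neg_add_cancel]
  have t := he.sum_antisymm (ricciForm g x) (fun i ↦ nab g (F i) ξ x) hanti
  simp only [ricciForm_apply, ← ric_apply, h.ric_comm (nab g _ ξ), ← two_mul,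
    ← Finset.mul_sum] at t
  rw [der_scal_eq_two_mul_sum hF]
  simp only [h.nabRic_comm _ ξ, nabRic_reeb hξ h, ip_comm g _ (nab g _ ξ), hξ.ip_nab_self,
    mul_zero, zero_sub, SmoothFun.neg_apply, Finset.sum_neg_distrib, SmoothFun.zero_apply]
  linarith

variable {μ κ : SmoothFun I M} (hμ : μ = constFun lam + constFun ρ * scal g)
  (hκ : κ = constFun (1 / m) * (μ - constFun ((Module.finrank ℝ E : ℝ) - 1)) - 1)

include hμ in
theorem der_reeb_coeff : der ξ μ = 0 := by
  rw [hμ, der_add, der_const_mul, der_const, der_reeb_scal hξ h, mul_zero, add_zero]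

include hμ hκ

/-- The derivative of `μ = lam + ρ r`, in terms of the function `κ = (μ - 2n - m) / m`. -/
theorem der_coeff (X : SmoothField I M) :
    der X μ = κ * (ip g V X - ip g V ξ * ip g X ξ) := by
  -- The left side is -g(R(X, ξ)ξ, V), known from the contact structure; on the right both
  -- derivatives of Ric and ξμ vanish.
  have h1 := h.ip_curv hμ X ξ ξ
  have h2 : nabRic g X ξ ξ = 0 := by
    rw [nabRic_reeb hξ h, h.ric_comm, hξ.ric_reeb, ip_comm, hξ.ip_nab_reeb]
    ring
  have h3 : nabRic g ξ X ξ = 0 := by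
    rw [nabRic_reeb hξ h, hξ.nab_reeb_self]
    ext x
    simp [ip_apply, ric_apply, ← ricciForm_apply]
  rw [ip_curv_swap, hξ.ip_curv_reeb_reeb, h2, h3, der_reeb_coeff hξ h hμ, hξ.ric_reeb,
    hξ.ric_reeb, hξ.unit, ip_comm g X V] at h1
  rw [hκ]
  linear_combination -h1

theorem der_excess (X : SmoothField I M) : der X κ = constFun (1 / m) * der X μ := by
  have h1 : (1 : SmoothFun I M) = constFun 1 := rfl
  rw [hκ, der_sub, der_const_mul, der_sub, der_const, sub_zero, h1, der_const, sub_zero]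

/-- This is d(dμ) = 0 for dμ = κ(V♭ - fη): dκ is proportional to V♭ - fη and V♭ is closed, so only
κ(df ∧ η + f dη) = 0 survives. -/
theorem excess_mul_inner_reeb (hd : 1 < Module.finrank ℝ E) : κ * ip g V ξ = 0 := by
  have hα := der_coeff hξ h hμ hκ
  have hsq : ∀ X, ip g (nab g X ξ) (nab g X ξ) = ip g X X - ip g X ξ * ip g X ξ := fun X ↦ by
    rw [hξ.killing, hξ.sq, ip_add_right, ip_neg_right, ip_smul_right]
    ring
  have key : ∀ X Y : SmoothField I M, κ * (der X (ip g V ξ) * ip g Y ξ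
      - der Y (ip g V ξ) * ip g X ξ
      + ip g V ξ * (ip g (nab g X ξ) Y + ip g (nab g X ξ) Y)) = 0 := fun X Y ↦ by
    have h1 := der_bracket X Y μ
    have h2 := hξ.killing X Y
    have h3 := h.closed X Y
    simp only [hα, der_mul, der_sub, der_excess hξ h hμ hκ, ← nab_sub_nab g, ip_sub_left,
      ip_sub_right, der_ip] at h1 h2 h3 ⊢
    rw [ip_comm g Y (nab g X ξ)] at h1
    linear_combination κ * h3 + κ * ip g V ξ * h2 + h1
  have h0 : ∀ W : SmoothField I M,
      κ * ip g V ξ * (ip g W W - ip g W ξ * ip g W ξ) = 0 := fun W ↦ by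
    -- On AW and A²W the terms with η drop out, and g(A²W, A²W) = |W|² - η(W)². Summed over a frame
    -- this is d - 1 > 0.
    have h1 := key (nab g W ξ) (nab g (nab g W ξ) ξ)
    rw [hsq, hξ.ip_nab_reeb, hξ.ip_nab_reeb, hsq] at h1
    ext x
    have h2 := DFunLike.congr_fun h1 x
    simp only [SmoothFun.mul_apply, SmoothFun.add_apply, SmoothFun.sub_apply,
      SmoothFun.zero_apply] at h2 ⊢
    linarith
  ext x
  obtain ⟨F, hF⟩ := exists_orthonormal_frame g x
  have he := hF.self_of_nhds
  have h1 : ∀ i, ip g (F i) (F i) x = 1 := fun i ↦ by simpa [ip_apply] using he i i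
  have h2 := sum_ip_mul_ip g he ξ ξ
  have h3 := Finset.sum_eq_zero (s := Finset.univ) fun i _ ↦ DFunLike.congr_fun (h0 (F i)) x
  simp only [SmoothFun.mul_apply, SmoothFun.sub_apply, ← Finset.mul_sum,
    Finset.sum_sub_distrib, h1, ip_comm g _ ξ, h2, hξ.unit, SmoothFun.one_apply] at h3
  have hd' : (1 : ℝ) < Module.finrank ℝ E := by exact_mod_cast hd
  simp only [Finset.sum_const, Finset.card_univ, Fintype.card_fin, nsmul_eq_mul, mul_one,
    mul_eq_zero] at h3
  rcases h3 with h3 | h3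
  · simpa [ip_comm g ξ V] using h3
  · linarith

theorem der_inner_reeb (X : SmoothField I M) :
    der X (ip g V ξ) = (μ - constFun ((Module.finrank ℝ E : ℝ) - 1)) * ip g X ξ
      + constFun (1 / m) * (ip g V X * ip g V ξ) + ip g V (nab g X ξ) := by
  rw [der_ip, h.equation, ← hμ, hξ.ric_reeb]
  ring

/-- Differentiate κf = 0. The terms with dκ or a factor f vanish because κf = 0, leaving κ((μ -
N)η(X) + g(V, AX)) = 0; then put X = ξ and X = AY. -/
theorem excess_mul_inner (hd : 1 < Module.finrank ℝ E) :
    κ * (μ - constFun ((Module.finrank ℝ E : ℝ) - 1)) = 0 ∧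
      ∀ X : SmoothField I M, κ * ip g V X = 0 := by
  have hf := excess_mul_inner_reeb hξ h hμ hκ hd
  have key : ∀ X : SmoothField I M, κ * ((μ - constFun ((Module.finrank ℝ E : ℝ) - 1)) * ip g X ξ
      + ip g V (nab g X ξ)) = 0 := fun X ↦ by
    have h0 : (0 : SmoothFun I M) = constFun 0 := rfl
    have h1 := congrArg (der X) hf
    rw [h0, der_const, der_mul, der_inner_reeb hξ h hμ hκ, der_excess hξ h hμ hκ,
      der_coeff hξ h hμ hκ] at h1
    linear_combination h1 - constFun (1 / m) * (ip g V X + ip g V X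
      - ip g V ξ * ip g X ξ) * hf
  have h1 : κ * (μ - constFun ((Module.finrank ℝ E : ℝ) - 1)) = 0 := by
    have h2 := key ξ
    have h3 : ip g V 0 = 0 := by ext; simp [ip_apply]
    rw [hξ.unit, hξ.nab_reeb_self, h3] at h2
    linear_combination h2
  refine ⟨h1, fun X ↦ ?_⟩
  have h2 := key (nab g X ξ)
  rw [hξ.ip_nab_reeb, hξ.sq, ip_add_right, ip_neg_right, ip_smul_right] at h2
  linear_combination -h2 + ip g X ξ * hf

theorem der_coeff_eq_zero (hd : 1 < Module.finrank ℝ E) (X : SmoothField I M) : der X μ = 0 := by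
  rw [der_coeff hξ h hμ hκ]
  linear_combination (excess_mul_inner hξ h hμ hκ hd).2 X
    - ip g X ξ * (excess_mul_inner hξ h hμ hκ hd).2 ξ

/-- Differentiate κV = 0, where dκ = 0, and insert the structure equation; κV = 0 and κ(μ - N) = 0
remove the rest. -/
theorem excess_mul_ric (hd : 1 < Module.finrank ℝ E) (X Y : SmoothField I M) :
    κ * (ric g X Y - constFun ((Module.finrank ℝ E : ℝ) - 1) * ip g X Y) = 0 := by
  obtain ⟨h1, h2⟩ := excess_mul_inner hξ h hμ hκ hd
  have h0 : (0 : SmoothFun I M) = constFun 0 := rfl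
  have h3 := congrArg (der X) (h2 Y)
  rw [h0, der_const, der_mul, der_ip, der_excess hξ h hμ hκ, der_coeff_eq_zero hξ h hμ hκ hd,
    h.equation, ← hμ] at h3
  linear_combination -h3 + h2 (nab g X Y) + ip g X Y * h1
    + constFun (1 / m) * ip g V Y * h2 X

theorem excess_mul_scal (hd : 1 < Module.finrank ℝ E) :
    κ * (scal g - constFun (((Module.finrank ℝ E : ℝ) - 1) * Module.finrank ℝ E)) = 0 := by
  ext x
  obtain ⟨F, hF⟩ := exists_orthonormal_frame g x
  have he := hF.self_of_nhds
  have h1 : ∀ i, ip g (F i) (F i) x = 1 := fun i ↦ by simpa [ip_apply] using he i i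
  have h2 : scal g x = _ := (eventually_scalarCurvature_eq_sum g hF).self_of_nhds
  have h3 := Finset.sum_eq_zero (s := Finset.univ) fun i _ ↦
    DFunLike.congr_fun (excess_mul_ric hξ h hμ hκ hd (F i) (F i)) x
  simp only [SmoothFun.mul_apply, SmoothFun.sub_apply, ← Finset.mul_sum, constFun_apply,
    Finset.sum_sub_distrib, h1, ← SmoothFun.sum_apply, ← h2] at h3
  simp only [Finset.sum_const, Finset.card_univ, Fintype.card_fin, nsmul_eq_mul, mul_one] at h3
  simp only [SmoothFun.mul_apply, SmoothFun.sub_apply, constFun_apply, SmoothFun.zero_apply]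
  linear_combination h3

/-- The trace of the Codazzi-type formula over X = Z with dμ = 0; the two derivatives of Ric
contribute -dr/2 + dr. -/
theorem ric_field (hd : 1 < Module.finrank ℝ E) (Y : SmoothField I M) (x : M) :
    ric g Y V x = 1 / m * (ip g V Y x * (μ x * ((Module.finrank ℝ E : ℝ) - 1) - scal g x)
      + ric g Y V x) + der Y (scal g) x / 2 := by
  obtain ⟨F, hF⟩ := exists_orthonormal_frame g x
  have he := hF.self_of_nhds
  have h0 : ∀ i, ip g (F i) (F i) x = 1 := fun i ↦ by simpa [ip_apply] using he i i
  have h1 : ric g Y V x = ∑ i, ip g (curv g (F i) Y V) (F i) x :=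
    (eventually_ricci_eq_sum g hF Y V).self_of_nhds.trans (SmoothFun.sum_apply _ _ _)
  have h2 : scal g x = ∑ i, ric g (F i) (F i) x :=
    (eventually_scalarCurvature_eq_sum g hF).self_of_nhds.trans (SmoothFun.sum_apply _ _ _)
  have h3 := der_scal_eq_two_mul_sum hF Y
  have h4 := der_scal_eq_sum hF Y
  have h5 := sum_ip_mul_ip g he V Y
  have h6 := sum_ip_mul_ric g he Y V
  have h7 : ∀ i, ip g (curv g (F i) Y V) (F i) x
      = 1 / m * ip g V Y x * (μ x - ric g (F i) (F i) x)
        - 1 / m * μ x * (ip g V (F i) x * ip g Y (F i) x)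
        + 1 / m * (ip g V (F i) x * ric g Y (F i) x)
        - nabRic g (F i) Y (F i) x + nabRic g Y (F i) (F i) x := fun i ↦ by
    rw [h.ip_curv hμ]
    simp only [der_coeff_eq_zero hξ h hμ hκ hd, SmoothFun.add_apply, SmoothFun.sub_apply,
      SmoothFun.mul_apply, SmoothFun.zero_apply, constFun_apply, h0]
    ring
  have h8 := h1
  simp only [h7, Finset.sum_add_distrib, Finset.sum_sub_distrib, ← Finset.mul_sum, h5, h6, ← h4,
    ← h2] at h8
  simp only [Finset.sum_const, Finset.card_univ, Fintype.card_fin, nsmul_eq_mul] at h8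
  linear_combination h8 + h3 / 2

/-- With h = r - Nd, three relations combine: fh = 0, its derivative along ξ, (μ - N + f²/m)h = 0,
and κh = 0. Since mκ = μ - N - m, they leave mh = 0. -/
theorem scal_eq (hd : 1 < Module.finrank ℝ E) :
    scal g = constFun (((Module.finrank ℝ E : ℝ) - 1) * Module.finrank ℝ E) := by
  have hm := h.m_pos.ne'
  have hκx : ∀ x, m * κ x = μ x - ((Module.finrank ℝ E : ℝ) - 1) - m := fun x ↦ by
    rw [hκ]
    simp only [SmoothFun.sub_apply, SmoothFun.mul_apply, constFun_apply, SmoothFun.one_apply]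
    field_simp
  have hfh : ip g V ξ
      * (scal g - constFun (((Module.finrank ℝ E : ℝ) - 1) * Module.finrank ℝ E)) = 0 := by
    ext x
    -- Ric(ξ, V) = Nf and ξr = 0 make this algebraic in f, and κf = 0 replaces μf by (N + m)f.
    have h1 := ric_field hξ h hμ hκ hd ξ x
    have h2 := DFunLike.congr_fun (excess_mul_inner_reeb hξ h hμ hκ hd) x
    rw [h.ric_comm, hξ.ric_reeb, der_reeb_scal hξ h] at h1
    simp only [SmoothFun.sub_apply, SmoothFun.mul_apply, constFun_apply,
      SmoothFun.zero_apply] at h1 h2 ⊢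
    field_simp at h1
    linear_combination h1 / 2 + ((Module.finrank ℝ E : ℝ) - 1) * m * h2
      - ((Module.finrank ℝ E : ℝ) - 1) * ip g V ξ x * hκx x
  ext x
  have h0 : (0 : SmoothFun I M) = constFun 0 := rfl
  have h1 := congrArg (der ξ) hfh
  rw [h0, der_const, der_mul, der_sub, der_const, der_reeb_scal hξ h, der_inner_reeb hξ h hμ hκ,
    hξ.unit, hξ.nab_reeb_self] at h1
  have h3 : ip g V 0 = 0 := by ext; simp [ip_apply]
  rw [h3] at h1
  replace h1 := DFunLike.congr_fun h1 x
  have h2 := DFunLike.congr_fun (excess_mul_scal hξ h hμ hκ hd) x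
  have h4 := DFunLike.congr_fun hfh x
  simp only [SmoothFun.sub_apply, SmoothFun.mul_apply, SmoothFun.add_apply, constFun_apply,
    SmoothFun.one_apply, SmoothFun.zero_apply] at h1 h2 h4 ⊢
  have h5 : m * (scal g x - ((Module.finrank ℝ E : ℝ) - 1) * Module.finrank ℝ E) = 0 := by
    linear_combination h1 - m * h2 - 1 / m * ip g V ξ x * h4
      + (scal g x - ((Module.finrank ℝ E : ℝ) - 1) * Module.finrank ℝ E) * hκx x
  have h6 := (mul_eq_zero.1 h5).resolve_left hm
  linarith

/-- With r = Nd and μV = (N + m)V, `ric_field` collapses to (m - 1)(QV - NV) = 0; this is where m ≠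
1 enters. -/
theorem ric_field_eq (hd : 1 < Module.finrank ℝ E) (hm1 : m ≠ 1) (Y : SmoothField I M) :
    ric g Y V = constFun ((Module.finrank ℝ E : ℝ) - 1) * ip g Y V := by
  have hm := h.m_pos.ne'
  ext x
  have hκx : m * κ x = μ x - ((Module.finrank ℝ E : ℝ) - 1) - m := by
    rw [hκ]
    simp only [SmoothFun.sub_apply, SmoothFun.mul_apply, constFun_apply, SmoothFun.one_apply]
    field_simp
  have h1 := ric_field hξ h hμ hκ hd Y x
  have h2 := DFunLike.congr_fun ((excess_mul_inner hξ h hμ hκ hd).2 Y) x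
  rw [scal_eq hξ h hμ hκ hd, der_const] at h1
  rw [ip_comm g Y V]
  simp only [SmoothFun.mul_apply, constFun_apply, SmoothFun.zero_apply] at h1 h2 ⊢
  field_simp at h1
  have h3 : (m - 1) * (ric g Y V x - ((Module.finrank ℝ E : ℝ) - 1) * ip g V Y x) = 0 := by
    linear_combination h1 / 2 + ((Module.finrank ℝ E : ℝ) - 1) * m * h2
      - ((Module.finrank ℝ E : ℝ) - 1) * ip g V Y x * hκx
  have h4 := (mul_eq_zero.1 h3).resolve_left (sub_ne_zero.2 hm1)
  linarith

/-- A K-contact manifold with a closed quasi-Einstein structure, `m ≠ 1`, is Einstein. -/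
theorem ricci_eq (hd : 1 < Module.finrank ℝ E) (hm1 : m ≠ 1) (x : M) (u v : TangentSpace I x) :
    ricci g x u v = ((Module.finrank ℝ E : ℝ) - 1) * g.inner x u v := by
  obtain ⟨F, hF⟩ := exists_orthonormal_frame g x
  have he := hF.self_of_nhds
  set N : ℝ := (Module.finrank ℝ E : ℝ) - 1 with hN
  -- The Ricci operator, read off from the structure equation and hence smooth.
  let Q : SmoothField I M → SmoothField I M := fun X ↦
    μ • X + (constFun (1 / m) * ip g V X) • V - nab g X V
  have hQ : ∀ X Y, ip g (Q X) Y = ric g X Y := fun X Y ↦ by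
    simp only [Q, ip_sub_left, ip_add_left, ip_smul_left, h.equation, ← hμ]
    ring
  have hr := ric_field_eq hξ h hμ hκ hd hm1
  have hs := scal_eq hξ h hμ hκ hd
  have h0 : ∀ i, ip g (F i) (F i) x = 1 := fun i ↦ by simpa [ip_apply] using he i i
  have h2 : ∑ i, ric g (F i) (F i) x = N * (N + 1) := by
    have : scal g x = ∑ i, ric g (F i) (F i) x :=
      (eventually_scalarCurvature_eq_sum g hF).self_of_nhds.trans (SmoothFun.sum_apply _ _ _)
    rw [← this, hs, constFun_apply, hN]
    ring
  -- Differentiating QV = NV and tracing: the divergence of Ric is dr/2 = 0.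
  have hdiv : ∑ i, (N * ip g (F i) (nab g (F i) V) x - ric g (F i) (nab g (F i) V) x) = 0 := by
    have h3 := der_scal_eq_two_mul_sum hF V
    have h4 : ∀ X, nabRic g X V X = constFun N * ip g X (nab g X V) - ric g X (nab g X V) :=
      fun X ↦ by
        rw [h.nabRic_comm, nabRic, hr, hr, der_const_mul, der_ip]
        ring
    rw [hs, der_const] at h3
    simp only [h4, SmoothFun.sub_apply, SmoothFun.mul_apply, constFun_apply,
      SmoothFun.zero_apply] at h3
    linarith
  -- Inserting ∇V = μ + V♭ ⊗ V/m - Q into `hdiv` produces tr Q²; the V terms cancel by QV = NV, and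
  -- tr Q = N(N + 1) makes |Q - N|² vanish.
  have hnorm : ∑ i, g.inner x (Q (F i) x - N • F i x) (Q (F i) x - N • F i x) = 0 := by
    have h5 : ∀ i, g.inner x (Q (F i) x - N • F i x) (Q (F i) x - N • F i x)
        = (μ x - N) * ric g (F i) (F i) x - N * μ x + N ^ 2
          + (N * ip g (F i) (nab g (F i) V) x - ric g (F i) (nab g (F i) V) x) := fun i ↦ by
      have h6 : ip g (Q (F i)) (Q (F i)) = μ * ric g (F i) (F i)
          + constFun (1 / m) * ip g V (F i) * (constFun N * ip g (F i) V)
          - ric g (F i) (nab g (F i) V) := by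
        rw [hQ]
        simp only [Q, ric_sub_right, ric_add_right, ric_smul_right, hr, hN]
      have h7 := h.equation (F i) (F i)
      rw [← hμ, ip_comm g (nab g (F i) V)] at h7
      have h8 := hQ (F i) (F i)
      replace h6 := DFunLike.congr_fun h6 x
      replace h7 := DFunLike.congr_fun h7 x
      replace h8 := DFunLike.congr_fun h8 x
      rw [ip_comm g (F i) V] at h6
      simp only [SmoothFun.sub_apply, SmoothFun.add_apply, SmoothFun.mul_apply, constFun_apply,
        h0] at h6 h7
      have h9 := h0 i
      simp only [map_sub, sub_apply, map_smul, smul_apply, smul_eq_mul]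
      rw [g.symm x (F i x) (Q (F i) x)]
      simp only [← ip_apply]
      rw [h6, h7, h8, h9]
      ring
    simp only [h5, Finset.sum_add_distrib, Finset.sum_sub_distrib, ← Finset.mul_sum] at hdiv ⊢
    rw [h2, hdiv]
    simp only [Finset.sum_const, Finset.card_univ, Fintype.card_fin, nsmul_eq_mul]
    rw [show (Module.finrank ℝ E : ℝ) = N + 1 by rw [hN]; ring]
    ring
  have hQF : ∀ i, Q (F i) x = N • F i x := fun i ↦ by
    have hnn : ∀ w : TangentSpace I x, 0 ≤ g.inner x w w := fun w ↦ by
      rcases eq_or_ne w 0 with rfl | hw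
      · simp
      · exact (g.pos x w hw).le
    have := (Finset.sum_eq_zero_iff_of_nonneg fun i _ ↦ hnn _).1 hnorm i (Finset.mem_univ i)
    exact sub_eq_zero.1 ((inner_self_eq_zero g).1 this)
  obtain ⟨Y, rfl⟩ := exists_smoothField_apply_eq v
  have h6 : ∀ i, ricci g x (F i x) (Y x) = N * g.inner x (F i x) (Y x) := fun i ↦ by
    rw [← ric_apply, ← hQ, ip_apply, hQF]
    simp
  have h7 := congrArg (fun w ↦ ricciForm g x w (Y x)) (he.sum_inner_smul u)
  have h8 := congrArg (fun w ↦ g.inner x w (Y x)) (he.sum_inner_smul u)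
  simp only [map_sum, map_smul, LinearMap.sum_apply, LinearMap.smul_apply, ricciForm_apply, h6,
    sum_apply, smul_apply, smul_eq_mul] at h7 h8
  rw [← h7, ← h8, Finset.mul_sum]
  exact Finset.sum_congr rfl fun i _ ↦ by ring

end Reeb

end IsQuasiEinsteinField

end QuasiEinstein

end RiemGeom

end

/-! ### The theorem in dimension 2n+1. -/

theorem theorem3p1 {n : ℕ} (hn : 1 ≤ n)
    {M : Type*} [TopologicalSpace M] [T2Space M] [SecondCountableTopology M]
    [ChartedSpace (EuclideanSpace ℝ (Fin (2 * n + 1))) M] [IsManifold (𝓡 (2 * n + 1)) ∞ M]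
    (g : ContMDiffRiemannianMetric (𝓡 (2 * n + 1)) ∞ (EuclideanSpace ℝ (Fin (2 * n + 1)))
      (fun x : M ↦ TangentSpace (𝓡 (2 * n + 1)) x))
    (φ : Π x : M, TangentSpace (𝓡 (2 * n + 1)) x →L[ℝ] TangentSpace (𝓡 (2 * n + 1)) x)
    (ξ : Π x : M, TangentSpace (𝓡 (2 * n + 1)) x)
    (η : Π x : M, TangentSpace (𝓡 (2 * n + 1)) x →L[ℝ] ℝ)
    (hK : RiemGeom.IsKContact g φ ξ η)
    (m ρ lam : ℝ) (V : Π x : M, TangentSpace (𝓡 (2 * n + 1)) x)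
    (hV : RiemGeom.IsClosedQuasiEinstein g m ρ lam V) (hm : m ≠ 1) :
    (∀ (x : M) (u v : TangentSpace (𝓡 (2 * n + 1)) x),
        RiemGeom.ricci g x u v = 2 * (n : ℝ) * g.inner x u v) ∧
      (∀ x : M, RiemGeom.scalarCurvature g x = 2 * (n : ℝ) * (2 * (n : ℝ) + 1)) ∧
      ((∀ x : M, V x = 0) ∨
        ∀ x : M, lam + ρ * RiemGeom.scalarCurvature g x = 2 * (n : ℝ) + m) := by
  have hfin : Module.finrank ℝ (EuclideanSpace ℝ (Fin (2 * n + 1))) = 2 * n + 1 :=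
    finrank_euclideanSpace_fin
  have hd : 1 < Module.finrank ℝ (EuclideanSpace ℝ (Fin (2 * n + 1))) := by omega
  have hN : (Module.finrank ℝ (EuclideanSpace ℝ (Fin (2 * n + 1))) : ℝ) = 2 * n + 1 := by
    rw [hfin]
    push_cast
    rfl
  have hscal := RiemGeom.IsQuasiEinsteinField.scal_eq hK.isReebField hV.isQuasiEinsteinField rfl
    rfl hd
  have hr : ∀ x : M, RiemGeom.scalarCurvature g x = 2 * (n : ℝ) * (2 * (n : ℝ) + 1) := fun x ↦ by
    rw [← RiemGeom.scal_apply, hscal, RiemGeom.constFun_apply, hN]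
    ring
  refine ⟨fun x u v ↦ ?_, hr, ?_⟩
  · rw [RiemGeom.IsQuasiEinsteinField.ricci_eq hK.isReebField hV.isQuasiEinsteinField rfl rfl hd hm,
      hN]
    ring
  · refine or_iff_not_imp_right.2 fun hne x ↦ ?_
    have hκ := DFunLike.congr_fun ((RiemGeom.IsQuasiEinsteinField.excess_mul_inner hK.isReebField
      hV.isQuasiEinsteinField rfl rfl hd).2 ⟨V, hV.smooth_V⟩) x
    simp only [RiemGeom.SmoothFun.mul_apply, RiemGeom.SmoothFun.sub_apply,
      RiemGeom.SmoothFun.add_apply, RiemGeom.constFun_apply, RiemGeom.SmoothFun.zero_apply,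
      RiemGeom.SmoothFun.one_apply, RiemGeom.scal_apply, mul_eq_zero] at hκ
    rcases hκ with hκ | hκ
    -- Here κ = 0 at the one point x; since r is the same number everywhere, so is μ, and the
    -- equation passes to every y without connectedness.
    · refine absurd (fun y ↦ ?_) hne
      have hm0 := hV.m_pos.ne'
      rw [hN] at hκ
      rw [hr] at hκ ⊢
      field_simp at hκ
      linarith
    · exact (RiemGeom.inner_self_eq_zero g).1 hκ
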